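/- Let $n\ge 1$, $N,L\ge 0$, $\tau=e^{2\pi i/n}$, let $G\in GL_N(\mathbb C)$ satisfy $G^n=1$, and put $\sigma(X)=G^{-1}XG$. Fix $\hbar\in\mathbb R$, $\lambda\in\mathbb C$, $\mu_k\in\mathbb C$ $(k\in\mathbb Z_n)$ and $\epsilon\in\{1,-1\}$. Consider $L$ particles on the $n$ half-lines $\tau^k\mathbb R^+$, with positions $q_i=\tau^{\kappa_i}t_i$ ($t_i>0$, $\kappa_i\in\mathbb Z_n$), and let $\mathcal W$ be the space of wave functions with values in $(\mathbb C^N)^{\otimes L}$ that are smooth where the $t_i$ are pairwise distinct. On $\mathcal W$ let $\mathcal P_s$ and $P_s$ ($s\in S_L$) permute the positions and the spins, write $\mathcal P_{ij},P_{ij}$ for the transposition $s=(ij)$, let $(\mathcal Q_i\psi)(\dots,q_i,\dots)=\psi(\dots,\tau q_i,\dots)$, let $M_i$ be the action of a matrix $M\in \mathrm{Mat}_N(\mathbb C)$ on the $i$-th spin, and let $$d_i=-i\hbar\frac{\partial}{\partial q_i}+\lambda\sum_{j\ne i}\sum_{k\in\mathbb Z_n}\frac{1}{q_i-\tau^kq_j}\,\mathcal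 Q_i^{-k}\mathcal P_{ij}\mathcal Q_i^{k}+\sum_{k\in\mathbb Z_n}\frac{\mu_k}{q_i}\mathcal Q_i^k$$ be the Dunkl operators. Let $$\Lambda_P=\frac1{L!}\sum_{s\in S_L}\epsilon^{|s|}\mathcal P_sP_s,\qquad \Lambda_Q=\prod_{i=1}^L\frac1n\sum_{j\in\mathbb Z_n}\mathcal Q_i^jG_i^{-j},$$ where $|s|\in\{0,1\}$ is the parity of $s$, and let $\mathcal H\subset\mathcal W$ be the space of physical states, i.e. of the $\psi$ with $P_{ij}\mathcal P_{ij}\psi=\epsilon\psi$ for $i\ne j$ (exchange statistics) and $G_i\psi=\mathcal Q_i\psi$ for all $i$ (quasi-parity). With an auxiliary space $\mathbb C^N$ labelled $a$, let $E_{ij}$ be the matrix units, $P_{a\ell}=\sum_{i,j}E_{ij}\otimes(E_{ji})_\ell$, and define the formal series in $u^{-1}$ $$T_a(u)=\sum_{\ell=1}^L\sum_{p\ge 0}\frac{P_{a\ell}\,d_\ell^{\,p}}{u^{p+1}},\qquad B_a(u)=\sum_{j\in\mathbb Z_n}\tau^jG_a^jT_a(\tau^ju)G_a^{-j},\qquad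 \widetilde B(u)=B(u)\Lambda_P\Lambda_Q=\sum_{p\ge0}\frac{\widetilde B^{(p)}}{u^{p+1}} .$$ Then: 1. $\Lambda_P\Lambda_Q$ is a projector of $\mathcal W$ onto $\mathcal H$, and all coefficients of the entries of $\widetilde B(u)$ map $\mathcal W$ into $\mathcal H$; in particular they preserve exchange statistics and quasi-parity. 2. The twisted half-loop relations hold, with $P_{ab}=\sum_{i,j}E_{ij}\otimes E_{ji}$ and $\frac1{u-\tau^kv}=\sum_{m\ge0}\tau^{km}v^mu^{-m-1}$: $$[\widetilde B_a(u),\widetilde B_b(v)]=\sum_{k\in\mathbb Z_n}\Big[\tau^k\widetilde B_a(u)+\widetilde B_b(v),\frac{G_a^{-k}P_{ab}G_a^k}{u-\tau^kv}\Big].$$ 3. The charges $\widetilde I^{(k)}$ defined by $\mathrm{tr}_a\,\widetilde B_a(u)=\sum_{k\ge0}\widetilde I^{(k)}u^{-k-1}$ commute pairwise, and $\widetilde I^{(k)}=0$ unless $k\equiv0 \bmod n$. 4. The model has $\mathfrak{gl}_N[z]^\sigma=\{A(z)\in\mathfrak{gl}_N[z]\mid\sigma A(z)=A(\tau z)\}$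 as a symmetry: there is a homomorphism of complex Lie algebras $\rho$ from $\mathfrak{gl}_N[z]^\sigma$ to the operators on $\mathcal W$ such that $\rho\big(\sum_{k\in\mathbb Z_n}\tau^{-pk}\sigma^k(E_{ji})z^p\big)=\widetilde B^{(p)}_{ij}$ for all $p,i,j$ (these elements lie in and span $\mathfrak{gl}_N[z]^\sigma$), all $\rho(x)$ map $\mathcal W$ into $\mathcal H$, and all $\rho(x)$ commute with all $\widetilde I^{(k)}$. -/

import Mathlib

open scoped ContDiff Kronecker

attribute [local instance] LieRing.ofAssociativeRing

noncomputable section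

namespace TwistedCalogero

/-! ### Roots of unity and the star graph -/

/-- `root k = τ ^ k = exp (2 π i k / n)` for `k` in `ℤ / n`. -/
def root {n : ℕ} [NeZero n] (k : ZMod n) : ℂ := ZMod.stdAddChar k

theorem root_eq_exp {n : ℕ} [NeZero n] (k : ZMod n) :
    root k = Complex.exp (2 * Real.pi * Complex.I * (k.val : ℂ) / (n : ℂ)) := by
  have h := ZMod.stdAddChar_coe (N := n) (k.val : ℤ)
  simpa [root] using h

theorem norm_root {n : ℕ} [NeZero n] (k : ZMod n) : ‖root k‖ = 1 := by
  rw [root, ZMod.stdAddChar_apply]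
  exact Circle.norm_coe _

theorem root_ne_zero {n : ℕ} [NeZero n] (k : ZMod n) : root k ≠ 0 := by
  intro h
  have := norm_root k
  simp [h] at this

/-- The regular set: `L` particles at pairwise distinct positive distances from the node.
Together with a choice `κ : Fin L → ZMod n` of branches, `t ∈ regular L` describes the positions
`q i = τ ^ κ i * t i` with `q i ≠ 0` and `q i ≠ τ ^ k * q j` for `i ≠ j`, `k ∈ ℤ / n`. -/
def regular (L : ℕ) : Set (Fin L → ℝ) := {t | (∀ i, 0 < t i) ∧ Function.Injective t}

theorem isOpen_regular (L : ℕ) : IsOpen (regular L) := by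
  have h : regular L = (⋂ i, {t : Fin L → ℝ | 0 < t i}) ∩
      ⋂ i, ⋂ j, ⋂ _ : i ≠ j, {t : Fin L → ℝ | t i ≠ t j} := by
    ext t
    simp only [regular, Set.mem_ofPred_eq, Set.mem_inter_iff, Set.mem_iInter, Function.Injective]
    refine and_congr_right fun _ => ⟨fun h i j hij hh => hij (h hh), fun h i j hh => ?_⟩
    by_contra hij
    exact h i j hij hh
  rw [h]
  refine IsOpen.inter (isOpen_iInter_of_finite fun i => ?_)
    (isOpen_iInter_of_finite fun i => isOpen_iInter_of_finite fun j =>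
      isOpen_iInter_of_finite fun _ => ?_)
  · exact isOpen_lt continuous_const (continuous_apply i)
  · exact isOpen_ne_fun (continuous_apply i) (continuous_apply j)

theorem comp_perm_mem_regular {L : ℕ} (s : Equiv.Perm (Fin L)) {t : Fin L → ℝ} :
    (fun i => t (s i)) ∈ regular L ↔ t ∈ regular L := by
  constructor
  · rintro ⟨h1, h2⟩
    refine ⟨fun i => by simpa using h1 (s.symm i), fun i j hij => ?_⟩
    have := @h2 (s.symm i) (s.symm j) (by simpa using hij)
    simpa using this
  · rintro ⟨h1, h2⟩
    exact ⟨fun i => h1 _, fun i j hij => s.injective (h2 hij)⟩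

/-- The position `q i = τ ^ κ i * t i` of the `i`-th particle, on the branch `τ ^ κ i * ℝ⁺`. -/
def pos {n L : ℕ} [NeZero n] (i : Fin L) (κ : Fin L → ZMod n) (t : Fin L → ℝ) : ℂ :=
  root (κ i) * (t i : ℂ)

/-! ### Wave functions and the operators acting on them -/

/-- Smooth wave functions of `L` particles with spin in `ℂ ^ N` on `n` half-lines:
`ψ κ v t` is the component along `e (v 1) ⊗ ⋯ ⊗ e (v L)` of the wave function at the positions
`q i = τ ^ κ i * t i`. Only `t ∈ regular L` matters, and `ψ` is extended by zero elsewhere. -/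
def WaveFn (n N L : ℕ) :
    Submodule ℂ ((Fin L → ZMod n) → (Fin L → Fin N) → (Fin L → ℝ) → ℂ) where
  carrier := {ψ | ∀ κ v, ContDiffOn ℝ ∞ (ψ κ v) (regular L) ∧ ∀ t, t ∉ regular L → ψ κ v t = 0}
  add_mem' := by
    intro a b ha hb κ v
    refine ⟨(ha κ v).1.add (hb κ v).1, fun t ht => ?_⟩
    simp [(ha κ v).2 t ht, (hb κ v).2 t ht]
  zero_mem' := fun κ v => ⟨contDiffOn_const, fun _ _ => rfl⟩
  smul_mem' := by
    intro c a ha κ v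
    refine ⟨(ha κ v).1.const_smul c, fun t ht => ?_⟩
    simp [(ha κ v).2 t ht]

/-- Operators on wave functions. -/
abbrev Op (n N L : ℕ) : Type := Module.End ℂ (WaveFn n N L)

variable {n N L : ℕ}

/-- Permutation of positions, `ψ(q | v) ↦ ψ(q ∘ s | v)`; for `s = (i j)` it exchanges the
positions of the particles `i` and `j`. -/
def posPerm (s : Equiv.Perm (Fin L)) : Op n N L where
  toFun ψ := ⟨fun κ v t => ψ.1 (fun i => κ (s i)) v (fun i => t (s i)), fun κ v => by
    refine ⟨?_, fun t ht => (ψ.2 _ v).2 _ fun h => ht ((comp_perm_mem_regular s).1 h)⟩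
    exact (ψ.2 _ v).1.comp (contDiff_pi.2 fun i => contDiff_apply ℝ ℝ (s i)).contDiffOn
      fun t ht => (comp_perm_mem_regular s).2 ht⟩
  map_add' _ _ := rfl
  map_smul' _ _ := rfl

/-- Permutation of spins; for `s = (i j)` it exchanges the spins of the particles `i`
and `j`. -/
def spinPerm (s : Equiv.Perm (Fin L)) : Op n N L where
  toFun ψ := ⟨fun κ v t => ψ.1 κ (fun i => v (s i)) t, fun κ _ => ψ.2 κ _⟩
  map_add' _ _ := rfl
  map_smul' _ _ := rfl

/-- The power `Q i ^ k` of the operator `Q i` moving the particle `i` between branches: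
`ψ(…, q i, …) ↦ ψ(…, τ ^ k * q i, …)`. -/
def branch (i : Fin L) (k : ZMod n) : Op n N L where
  toFun ψ := ⟨fun κ v t => ψ.1 (Function.update κ i (k + κ i)) v t, fun _ v => ψ.2 _ v⟩
  map_add' _ _ := rfl
  map_smul' _ _ := rfl

theorem branch_zero (i : Fin L) : (branch i 0 : Op n N L) = 1 := by
  ext ψ κ v t
  simp [branch]

theorem branch_add (i : Fin L) (k l : ZMod n) :
    (branch i (k + l) : Op n N L) = branch i k * branch i l := by
  ext ψ κ v t
  simp only [branch, LinearMap.coe_mk, AddHom.coe_mk, Module.End.mul_apply,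
    Function.update_self, Function.update_idem]
  rw [← add_assoc, add_comm l k]

/-- The moved particle sits at `τ ^ k * q i`. -/
theorem pos_update [NeZero n] (i : Fin L) (k : ZMod n) (κ : Fin L → ZMod n) (t : Fin L → ℝ) :
    pos i (Function.update κ i (k + κ i)) t = root k * pos i κ t := by
  simp [pos, root, AddChar.map_add_eq_mul, mul_assoc]

/-- The matrix `M` acting on the spin of the particle `i`. -/
def spin (i : Fin L) (M : Matrix (Fin N) (Fin N) ℂ) : Op n N L where
  toFun ψ := ⟨fun κ v t => ∑ w, M (v i) w * ψ.1 κ (Function.update v i w) t, fun κ v =>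
    ⟨ContDiffOn.sum fun w _ => contDiffOn_const.mul (ψ.2 κ _).1, fun t ht =>
      Finset.sum_eq_zero fun w _ => by rw [(ψ.2 κ _).2 t ht, mul_zero]⟩⟩
  map_add' a b := by
    ext κ v t
    simp [mul_add, Finset.sum_add_distrib]
  map_smul' c a := by
    ext κ v t
    simp [Finset.mul_sum, mul_left_comm]

/-- Multiplication by a function which is smooth on the regular set. -/
def mulBy (f : (Fin L → ZMod n) → (Fin L → ℝ) → ℂ)
    (hf : ∀ κ, ContDiffOn ℝ ∞ (f κ) (regular L)) : Op n N L where
  toFun ψ := ⟨fun κ v t => f κ t * ψ.1 κ v t, fun κ v =>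
    ⟨(hf κ).mul (ψ.2 κ v).1, fun t ht => by simp [(ψ.2 κ v).2 t ht]⟩⟩
  map_add' a b := by
    ext κ v t
    simp [mul_add]
  map_smul' c a := by
    ext κ v t
    simp [mul_left_comm]

open Classical in
/-- The momentum `p i = - i ħ ∂ / ∂ q i`. On the branch `q i = τ ^ κ i * t i` the derivative
`∂ / ∂ q i` is `τ ^ (- κ i) * ∂ / ∂ t i`. -/
def momentum [NeZero n] (ℏ : ℝ) (i : Fin L) : Op n N L where
  toFun ψ := ⟨fun κ v t => if t ∈ regular L then
      -Complex.I * (ℏ : ℂ) * root (-κ i) * fderiv ℝ (ψ.1 κ v) t (Pi.single i 1) else 0,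
    fun κ v => by
      refine ⟨?_, fun t ht => if_neg ht⟩
      have h1 : ContDiffOn ℝ ∞ (fun t => fderiv ℝ (ψ.1 κ v) t) (regular L) :=
        (ψ.2 κ v).1.fderiv_of_isOpen (isOpen_regular L) (by simp)
      have h2 : ContDiffOn ℝ ∞ (fun t => -Complex.I * (ℏ : ℂ) * root (-κ i) *
          fderiv ℝ (ψ.1 κ v) t (Pi.single i 1)) (regular L) :=
        contDiffOn_const.mul (h1.clm_apply contDiffOn_const)
      exact h2.congr fun t ht => if_pos ht⟩
  map_add' a b := by
    ext κ v t
    by_cases ht : t ∈ regular L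
    · have ha := ((a.2 κ v).1.contDiffAt ((isOpen_regular L).mem_nhds ht)).differentiableAt
        (by simp)
      have hb := ((b.2 κ v).1.contDiffAt ((isOpen_regular L).mem_nhds ht)).differentiableAt
        (by simp)
      have := fderiv_add ha hb
      simp [ht, this, mul_add]
    · simp [ht]
  map_smul' c a := by
    ext κ v t
    by_cases ht : t ∈ regular L
    · have ha := ((a.2 κ v).1.contDiffAt ((isOpen_regular L).mem_nhds ht)).differentiableAt
        (by simp)
      have := fderiv_const_smul ha c
      simp [ht, this, mul_left_comm]
    · simp [ht]

theorem contDiff_pos [NeZero n] (i : Fin L) (κ : Fin L → ZMod n) :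
    ContDiff ℝ ∞ (pos i κ) :=
  contDiff_const.mul (Complex.ofRealCLM.contDiff.comp (contDiff_apply ℝ ℝ i))

theorem norm_pos_eq [NeZero n] (i : Fin L) (κ : Fin L → ZMod n) {t : Fin L → ℝ}
    (ht : t ∈ regular L) : ‖pos i κ t‖ = t i := by
  rw [pos, norm_mul, norm_root, one_mul, Complex.norm_real, Real.norm_of_nonneg (ht.1 i).le]

theorem pos_ne_zero [NeZero n] (i : Fin L) (κ : Fin L → ZMod n) {t : Fin L → ℝ}
    (ht : t ∈ regular L) : pos i κ t ≠ 0 := by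
  rw [← norm_pos_iff, norm_pos_eq i κ ht]
  exact ht.1 i

theorem pos_sub_ne_zero [NeZero n] {i j : Fin L} (hij : i ≠ j) (k : ZMod n)
    (κ : Fin L → ZMod n) {t : Fin L → ℝ} (ht : t ∈ regular L) :
    pos i κ t - root k * pos j κ t ≠ 0 := by
  intro h
  have := congrArg norm (sub_eq_zero.1 h)
  rw [norm_mul, norm_root, one_mul, norm_pos_eq i κ ht, norm_pos_eq j κ ht] at this
  exact hij (ht.2 this)

/-- Multiplication by `1 / q i`. -/
def invPos [NeZero n] (i : Fin L) : Op n N L :=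
  mulBy (fun κ t => (pos i κ t)⁻¹) fun κ =>
    (contDiff_pos i κ).contDiffOn.inv fun _ ht => pos_ne_zero i κ ht

/-- Multiplication by `1 / (q i - τ ^ k * q j)`, for `i ≠ j`. -/
def invDiff [NeZero n] {i j : Fin L} (hij : i ≠ j) (k : ZMod n) : Op n N L :=
  mulBy (fun κ t => (pos i κ t - root k * pos j κ t)⁻¹) fun κ =>
    ContDiffOn.inv
      ((contDiff_pos i κ).sub (contDiff_const.mul (contDiff_pos j κ))).contDiffOn
      fun _ ht => pos_sub_ne_zero hij k κ ht

/-- The Dunkl operators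
`d i = p i + lam * ∑ j ≠ i, ∑ k, 1 / (q i - τ ^ k * q j) * Q i ^ (-k) * P (i j) * Q i ^ k
  + ∑ k, μ k / q i * Q i ^ k`. The operator `Q i ^ (-k) * P (i j) * Q i ^ k` is the reflection
`ψ(…, q i, …, q j, …) ↦ ψ(…, τ ^ k * q j, …, τ ^ (-k) * q i, …)`, whose mirror is
`q i = τ ^ k * q j`. -/
def dunkl [NeZero n] (ℏ : ℝ) (lam : ℂ) (μ : ZMod n → ℂ) (i : Fin L) : Op n N L :=
  momentum ℏ i
    + lam • (∑ j : {j : Fin L // i ≠ j}, ∑ k : ZMod n,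
        invDiff j.2 k * (branch i (-k) * posPerm (Equiv.swap i j.1) * branch i k) : Op n N L)
    + ∑ k : ZMod n, μ k • (invPos i * branch i k : Op n N L)

/-! ### Exchange statistics and quasi-parity -/

/-- The number of transpositions in a permutation, modulo two. -/
def parity (s : Equiv.Perm (Fin L)) : ℕ := if Equiv.Perm.sign s = 1 then 0 else 1

/-- The projector onto states of exchange statistics `ε`. -/
def statProj (ε : ℂ) : Op n N L :=
  (1 / (Nat.factorial L : ℂ)) • ∑ s : Equiv.Perm (Fin L),
    ε ^ parity s • (posPerm s * spinPerm s : Op n N L)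

/-- `gpow G k = G ^ k` for `k ∈ ℤ / n`, where `G ^ n = 1`. -/
def gpow (G : GL (Fin N) ℂ) (k : ZMod n) : Matrix (Fin N) (Fin N) ℂ :=
  ((G ^ k.val : GL (Fin N) ℂ) : Matrix (Fin N) (Fin N) ℂ)

/-- The quasi-parity projector `∏ i, (1 / n) * ∑ j, Q i ^ j * G i ^ (-j)`, the (commuting)
factors being multiplied in the order `i = 1, …, L`. -/
def parityProj [NeZero n] (G : GL (Fin N) ℂ) : Op n N L :=
  (List.ofFn fun i : Fin L =>
    (1 / (n : ℂ)) • ∑ j : ZMod n, (branch i j * spin i (gpow G (-j)) : Op n N L)).prod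

/-- The wave functions with exchange statistics `ε` and quasi-parity:
`P (i j) 𝓟 (i j) ψ = ε ψ` for `i ≠ j`, and `G i ψ = Q i ψ` for all `i`. -/
def physical (n L : ℕ) (ε : ℂ) (G : GL (Fin N) ℂ) : Submodule ℂ (WaveFn n N L) where
  carrier := {ψ | (∀ i j : Fin L, i ≠ j →
      (spinPerm (Equiv.swap i j) * posPerm (Equiv.swap i j) : Op n N L) ψ = ε • ψ) ∧
    ∀ i : Fin L, (spin i (G : Matrix (Fin N) (Fin N) ℂ) : Op n N L) ψ = branch i 1 ψ}
  add_mem' := by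
    intro a b ha hb
    refine ⟨fun i j hij => ?_, fun i => ?_⟩
    · rw [map_add, ha.1 i j hij, hb.1 i j hij, smul_add]
    · rw [map_add, map_add, ha.2 i, hb.2 i]
  zero_mem' := ⟨fun i j _ => by rw [map_zero, smul_zero], fun i => by rw [map_zero, map_zero]⟩
  smul_mem' := by
    intro c a ha
    refine ⟨fun i j hij => ?_, fun i => ?_⟩
    · rw [LinearMap.map_smul, ha.1 i j hij]
      exact smul_comm c ε a
    · rw [LinearMap.map_smul, LinearMap.map_smul, ha.2 i]

/-! ### The monodromy matrices

A formal series `∑ m, f m / u ^ m` is the power series with coefficients `f m`; its indeterminate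
stands for `u ^ (-1)`. -/

open PowerSeries in
/-- `T(u) = ∑ ℓ, P_{a ℓ} / (u - d ℓ)`, where `P_{a ℓ} = ∑ i j, E_{ij} ⊗ (E_{ji})_ℓ` and
`1 / (u - d ℓ) = ∑ p, d ℓ ^ p / u ^ (p + 1)`. -/
def monodromy [NeZero n] (ℏ : ℝ) (lam : ℂ) (μ : ZMod n → ℂ) :
    Matrix (Fin N) (Fin N) (Op n N L)⟦X⟧ :=
  Matrix.of fun i j => ∑ ℓ : Fin L,
    PowerSeries.C (spin ℓ (Matrix.single j i 1)) *
      (PowerSeries.X * PowerSeries.mk fun p => dunkl ℏ lam μ ℓ ^ p)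

open PowerSeries in
/-- The series `f(c * u)`, for `f(u) = ∑ m, f m / u ^ m` and `c ≠ 0`. -/
def dilate {A : Type*} [Ring A] [Algebra ℂ A] (c : ℂ) (f : A⟦X⟧) : A⟦X⟧ :=
  PowerSeries.mk fun m => (c⁻¹) ^ m • PowerSeries.coeff m f

open PowerSeries in
/-- A complex matrix as a constant matrix over a ring of series. -/
def constMat {ι : Type*} (A : Type*) [Ring A] [Algebra ℂ A] (M : Matrix ι ι ℂ) :
    Matrix ι ι A⟦X⟧ :=
  M.map fun c => PowerSeries.C (algebraMap ℂ A c)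

open PowerSeries in
/-- `B(u) = ∑ j, τ ^ j G ^ j T(τ ^ j u) G ^ (-j)`. -/
def twisted [NeZero n] (G : GL (Fin N) ℂ) (ℏ : ℝ) (lam : ℂ) (μ : ZMod n → ℂ) :
    Matrix (Fin N) (Fin N) (Op n N L)⟦X⟧ :=
  ∑ j : ZMod n, root j • (constMat (Op n N L) (gpow G j) *
    (monodromy ℏ lam μ : Matrix (Fin N) (Fin N) (Op n N L)⟦X⟧).map (dilate (root j)) * constMat (Op n N L) (gpow G (-j)))

open PowerSeries in
/-- `B̃(u) = B(u) Λ_P Λ_Q`. -/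
def modified [NeZero n] (G : GL (Fin N) ℂ) (ε : ℂ) (ℏ : ℝ) (lam : ℂ) (μ : ZMod n → ℂ) :
    Matrix (Fin N) (Fin N) (Op n N L)⟦X⟧ :=
  (twisted G ℏ lam μ).map fun f => f * PowerSeries.C (statProj ε * parityProj G : Op n N L)

/-- The charges `Ĩ^(k)`: the coefficients of `u ^ (-(k + 1))` in `tr B̃(u)`. -/
def charge [NeZero n] (G : GL (Fin N) ℂ) (ε : ℂ) (ℏ : ℝ) (lam : ℂ) (μ : ZMod n → ℂ) (k : ℕ) :
    Op n N L :=
  PowerSeries.coeff (k + 1)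
    (modified G ε ℏ lam μ : Matrix (Fin N) (Fin N) (PowerSeries (Op n N L))).trace

/-! ### The twisted half-loop relations -/

open PowerSeries in
/-- The ring `A((v⁻¹))[[u⁻¹]]`: power series in `u⁻¹` whose coefficients are Laurent series
in `v⁻¹`. -/
abbrev TwoSeries (A : Type*) [Ring A] : Type _ := (LaurentSeries A)⟦X⟧

open PowerSeries in
/-- The series `f(u)` in `A((v⁻¹))[[u⁻¹]]`. -/
def inU {A : Type*} [Ring A] : A⟦X⟧ →+* TwoSeries A := PowerSeries.map HahnSeries.C

open PowerSeries in
/-- The series `f(v)` in `A((v⁻¹))[[u⁻¹]]`. -/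
def inV {A : Type*} [Ring A] : A⟦X⟧ →+* TwoSeries A :=
  (PowerSeries.C (R := LaurentSeries A)).comp (HahnSeries.ofPowerSeries ℤ A)

/-- A complex number in `A((v⁻¹))[[u⁻¹]]`. -/
def scalar {A : Type*} [Ring A] [Algebra ℂ A] (c : ℂ) : TwoSeries A :=
  PowerSeries.C (HahnSeries.C (algebraMap ℂ A c))

/-- `1 / (u - c * v) = ∑ m, c ^ m * v ^ m / u ^ (m + 1)`. -/
def kernel {A : Type*} [Ring A] [Algebra ℂ A] (c : ℂ) : TwoSeries A :=
  PowerSeries.X * PowerSeries.mk fun m => HahnSeries.single (-(m : ℤ)) (algebraMap ℂ A (c ^ m))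

/-- The defining property `(u - c * v) * (1 / (u - c * v)) = 1`, multiplied by `u⁻¹`. -/
theorem kernel_spec {A : Type*} [Ring A] [Algebra ℂ A] (c : ℂ) :
    (1 - PowerSeries.C (HahnSeries.single (-1) (algebraMap ℂ A c)) * PowerSeries.X) * kernel c
      = (PowerSeries.X : TwoSeries A) := by
  have h : (1 - PowerSeries.C (HahnSeries.single (-1) (algebraMap ℂ A c)) * PowerSeries.X) *
      (PowerSeries.mk fun m : ℕ =>
        (HahnSeries.single (-(m : ℤ)) (algebraMap ℂ A (c ^ m)) : LaurentSeries A)) = 1 := by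
    ext1 m
    rw [sub_mul, one_mul, mul_assoc, map_sub, PowerSeries.coeff_C_mul]
    cases m with
    | zero => simp
    | succ m =>
      rw [PowerSeries.coeff_succ_X_mul, PowerSeries.coeff_mk, PowerSeries.coeff_mk,
        HahnSeries.single_mul_single, ← map_mul, ← pow_succ', PowerSeries.coeff_one]
      simp
  rw [kernel, ← mul_assoc, (PowerSeries.commute_X _).eq, mul_assoc, h, mul_one]

/-- Matrices acting in two auxiliary spaces `a` and `b`. -/
abbrev AuxMat (N : ℕ) (R : Type*) : Type _ := Matrix (Fin N × Fin N) (Fin N × Fin N) R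

/-- `X_a`: the matrix `X` in the auxiliary space `a`. -/
def inA {R : Type*} [Ring R] (Y : Matrix (Fin N) (Fin N) R) : AuxMat N R := Y ⊗ₖ 1

/-- `X_b`: the matrix `X` in the auxiliary space `b`. -/
def inB {R : Type*} [Ring R] (Y : Matrix (Fin N) (Fin N) R) : AuxMat N R := 1 ⊗ₖ Y

/-- The permutation operator `P_{ab} = ∑ i j, E_{ij} ⊗ E_{ji}`. -/
def permAB (N : ℕ) : AuxMat N ℂ :=
  ∑ i : Fin N, ∑ j : Fin N, Matrix.single i j 1 ⊗ₖ Matrix.single j i 1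

open PowerSeries in
/-- The relations
`[B_a(u), B_b(v)] = ∑ k, [τ ^ k B_a(u) + B_b(v), G_a ^ (-k) P_{ab} G_a ^ k / (u - τ ^ k v)]`. -/
def TwistedHalfLoop (n : ℕ) [NeZero n] {A : Type*} [Ring A] [Algebra ℂ A] (G : GL (Fin N) ℂ)
    (B : Matrix (Fin N) (Fin N) A⟦X⟧) : Prop :=
  ⁅inA (B.map inU), inB (B.map inV)⁆ = ∑ k : ZMod n,
    ⁅(scalar (root k) : TwoSeries A) • inA (B.map inU) + inB (B.map inV),
      (kernel (root k) : TwoSeries A) •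
        (inA (gpow G (-k)) * permAB N * inA (gpow G k)).map scalar⁆

/-! ### The twisted loop algebra -/

/-- `σ(Y) = G⁻¹ Y G`, extended to matrices of polynomials in `z`. -/
def sigma (G : GL (Fin N) ℂ) (Y : Matrix (Fin N) (Fin N) (Polynomial ℂ)) :
    Matrix (Fin N) (Fin N) (Polynomial ℂ) :=
  ((G⁻¹ : GL (Fin N) ℂ) : Matrix (Fin N) (Fin N) ℂ).map Polynomial.C * Y *
    (G : Matrix (Fin N) (Fin N) ℂ).map Polynomial.C

/-- `Y(z) ↦ Y(τ z)`. -/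
def rotate (n : ℕ) [NeZero n] (Y : Matrix (Fin N) (Fin N) (Polynomial ℂ)) :
    Matrix (Fin N) (Fin N) (Polynomial ℂ) :=
  Y.map fun p => p.comp (Polynomial.C (root (1 : ZMod n)) * Polynomial.X)

theorem sigma_add (G : GL (Fin N) ℂ) (Y Z : Matrix (Fin N) (Fin N) (Polynomial ℂ)) :
    sigma G (Y + Z) = sigma G Y + sigma G Z := by
  simp [sigma, mul_add, add_mul]

theorem sigma_smul (G : GL (Fin N) ℂ) (c : ℂ) (Y : Matrix (Fin N) (Fin N) (Polynomial ℂ)) :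
    sigma G (c • Y) = c • sigma G Y := by
  simp [sigma]

theorem sigma_mul (G : GL (Fin N) ℂ) (Y Z : Matrix (Fin N) (Fin N) (Polynomial ℂ)) :
    sigma G (Y * Z) = sigma G Y * sigma G Z := by
  have h : (G : Matrix (Fin N) (Fin N) ℂ).map Polynomial.C *
      ((G⁻¹ : GL (Fin N) ℂ) : Matrix (Fin N) (Fin N) ℂ).map Polynomial.C = 1 := by
    rw [← Matrix.map_mul, ← Units.val_mul, mul_inv_cancel, Units.val_one]
    exact Matrix.map_one _ (by simp) (by simp)
  have h' : ∀ Z : Matrix (Fin N) (Fin N) (Polynomial ℂ),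
      (G : Matrix (Fin N) (Fin N) ℂ).map Polynomial.C *
      (((G⁻¹ : GL (Fin N) ℂ) : Matrix (Fin N) (Fin N) ℂ).map Polynomial.C * Z) = Z := fun Z => by
    rw [← mul_assoc, h, one_mul]
  simp only [sigma, mul_assoc, h']

theorem rotate_add (n : ℕ) [NeZero n] (Y Z : Matrix (Fin N) (Fin N) (Polynomial ℂ)) :
    rotate n (Y + Z) = rotate n Y + rotate n Z := by
  ext1 i j
  simp [rotate]

theorem rotate_smul (n : ℕ) [NeZero n] (c : ℂ) (Y : Matrix (Fin N) (Fin N) (Polynomial ℂ)) :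
    rotate n (c • Y) = c • rotate n Y := by
  ext1 i j
  simp [rotate]

theorem rotate_mul (n : ℕ) [NeZero n] (Y Z : Matrix (Fin N) (Fin N) (Polynomial ℂ)) :
    rotate n (Y * Z) = rotate n Y * rotate n Z := by
  exact Matrix.map_mul (f := Polynomial.compRingHom _)

/-- The Lie algebra `gl_N[z]^σ = {Y ∈ gl_N[z] | σ Y(z) = Y(τ z)}`. -/
def twistedLoop (n : ℕ) [NeZero n] (G : GL (Fin N) ℂ) :
    LieSubalgebra ℂ (Matrix (Fin N) (Fin N) (Polynomial ℂ)) where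
  carrier := {Y | sigma G Y = rotate n Y}
  add_mem' := by
    intro Y Z hY hZ
    rw [Set.mem_ofPred_eq] at *
    rw [sigma_add, rotate_add, hY, hZ]
  zero_mem' := by
    ext1 i j
    simp [sigma, rotate]
  smul_mem' := by
    intro c Y hY
    rw [Set.mem_ofPred_eq] at *
    rw [sigma_smul, rotate_smul, hY]
  lie_mem' := by
    intro Y Z hY hZ
    change sigma G (Y * Z - Z * Y) = rotate n (Y * Z - Z * Y)
    have hY' : sigma G Y = rotate n Y := hY
    have hZ' : sigma G Z = rotate n Z := hZ
    rw [sub_eq_add_neg, ← neg_one_smul ℂ (Z * Y), sigma_add, rotate_add, sigma_smul, rotate_smul,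
      sigma_mul, sigma_mul, rotate_mul, rotate_mul, hY', hZ']

/-- The element `∑ k, τ ^ (-p k) σ ^ k (E_{ji}) z ^ p` of `gl_N[z]`, that is `n` times the
projection of `E_{ji} z ^ p` to `gl_N[z]^σ`. -/
def generator (n : ℕ) [NeZero n] (G : GL (Fin N) ℂ) (p : ℕ) (i j : Fin N) :
    Matrix (Fin N) (Fin N) (Polynomial ℂ) :=
  ∑ k : ZMod n, root (-((p : ZMod n) * k)) •
    (sigma G)^[k.val] (Matrix.single j i ((Polynomial.X : Polynomial ℂ) ^ p))

end TwistedCalogero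

end

open TwistedCalogero

/-!
The Dunkl operators are covariant under the wreath product of `ℤ / n` and `S_L`, and they commute
with each other: the terms quadratic in the exchange parts cancel by the partial fraction identity
`1 / (x * y) = (1 / x + 1 / y) * 1 / (x + y)` applied along the orbits of three particles. They also
commute with the spins, so that evaluating a matrix of polynomials `Y(z)` at `z = d i` on the spin
of particle `i`, and summing over the particles, is a representation of `gl_N[z]`.

By covariance, the operators representing `gl_N[z]^σ` commute with `Λ_P` and `Λ_Q`. Multiplication
by the projector `Λ_P Λ_Q` therefore gives a representation of `gl_N[z]^σ` with values in the
physical states, and `B̃(u)` is the generating series of the images under it of the generators of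
`gl_N[z]^σ`. The half-loop relations translate the Lie brackets of these generators, and the charges
are the images of the central elements `z ^ k * 1`, which vanish upon averaging unless `n ∣ k`.
-/

noncomputable section

namespace TwistedCalogero

variable {n N L : ℕ}

/-- Instance search for this ring structure is slow without a shortcut. -/
local instance instRingOp : Ring (Op n N L) := Module.End.instRing

section Root

variable [NeZero n]

theorem root_zero : root (0 : ZMod n) = 1 := by simp [root]

theorem root_add (k l : ZMod n) : root (k + l) = root k * root l := by
  simp [root, AddChar.map_add_eq_mul]

theorem root_neg (k : ZMod n) : root (-k) = (root k)⁻¹ := by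
  simp [root, AddChar.map_neg_eq_inv]

theorem root_sub (k l : ZMod n) : root (k - l) = root k / root l := by
  rw [sub_eq_add_neg, root_add, root_neg, div_eq_mul_inv]

end Root

/-! ### The action of the wreath product on positions -/

theorem op_ext {S T : Op n N L}
    (h : ∀ ψ κ v, ∀ t ∈ regular L, (S ψ).1 κ v t = (T ψ).1 κ v t) : S = T := by
  refine LinearMap.ext fun ψ => Subtype.ext (funext fun κ => funext fun v => funext fun t => ?_)
  by_cases ht : t ∈ regular L
  · exact h ψ κ v t ht
  · rw [((S ψ).2 κ v).2 t ht, ((T ψ).2 κ v).2 t ht]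

/-- The operator `ψ(κ, v, t) ↦ ψ(κ ∘ s + a, v, t ∘ s)`: the action on positions of the element
`(s, a)` of the wreath product of `ℤ / n` with the symmetric group. The operators `posPerm`,
`branch` and the reflections in the Dunkl operators are all of this form. -/
def act (s : Equiv.Perm (Fin L)) (a : Fin L → ZMod n) : Op n N L where
  toFun ψ := ⟨fun κ v t => ψ.1 (fun i => κ (s i) + a i) v (fun i => t (s i)), fun κ v => by
    refine ⟨?_, fun t ht => (ψ.2 _ v).2 _ fun h => ht ((comp_perm_mem_regular s).1 h)⟩
    exact (ψ.2 _ v).1.comp (contDiff_pi.2 fun i => contDiff_apply ℝ ℝ (s i)).contDiffOn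
      fun t ht => (comp_perm_mem_regular s).2 ht⟩
  map_add' _ _ := rfl
  map_smul' _ _ := rfl

theorem act_apply (s : Equiv.Perm (Fin L)) (a : Fin L → ZMod n) (ψ : WaveFn n N L) (κ v t) :
    ((act s a : Op n N L) ψ).1 κ v t = ψ.1 (fun i => κ (s i) + a i) v (fun i => t (s i)) := rfl

theorem act_mul_act (s s' : Equiv.Perm (Fin L)) (a a' : Fin L → ZMod n) :
    (act s a * act s' a' : Op n N L) = act (s * s') (fun i => a (s' i) + a' i) := by
  ext ψ κ v t
  simp only [Module.End.mul_apply, act_apply, Equiv.Perm.mul_apply, add_assoc]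

theorem posPerm_eq_act (s : Equiv.Perm (Fin L)) : (posPerm s : Op n N L) = act s 0 := by
  ext ψ κ v t
  simp [posPerm, act_apply]

theorem branch_eq_act (i : Fin L) (k : ZMod n) :
    (branch i k : Op n N L) = act 1 (Pi.single i k) := by
  ext ψ κ v t
  simp only [branch, LinearMap.coe_mk, AddHom.coe_mk, act_apply, Equiv.Perm.one_apply]
  refine congrArg (fun κ' => ψ.1 κ' v t) (funext fun m => ?_)
  by_cases h : m = i
  · subst h
    simp [add_comm]
  · simp [h]

theorem act_mul_branch (s : Equiv.Perm (Fin L)) (a : Fin L → ZMod n) (i : Fin L) (k : ZMod n) :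
    (act s a * branch i k : Op n N L) = branch (s i) k * act s a := by
  simp only [branch_eq_act, act_mul_act, mul_one, one_mul]
  congr 1
  ext m
  simp [Pi.single_apply, add_comm]

theorem branch_commute (i j : Fin L) (k m : ZMod n) :
    Commute (branch i k : Op n N L) (branch j m) := by
  rw [commute_iff_eq, branch_eq_act i, act_mul_branch, Equiv.Perm.one_apply]

/-- The reflection `Q i ^ (-k) * P (i j) * Q i ^ k`, whose mirror is `q i = τ ^ k * q j`. -/
def reflect (i j : Fin L) (k : ZMod n) : Op n N L :=
  act (Equiv.swap i j) (Pi.single i k + Pi.single j (-k))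

theorem branch_mul_posPerm_mul_branch (i j : Fin L) (k : ZMod n) :
    (branch i (-k) * posPerm (Equiv.swap i j) * branch i k : Op n N L) = reflect i j k := by
  simp only [branch_eq_act, posPerm_eq_act, act_mul_act, reflect, one_mul, mul_one]
  congr 1
  ext m
  rw [Pi.add_apply, add_comm]
  congr 1
  simp only [Equiv.Perm.one_apply, Pi.zero_apply, add_zero, Pi.single_apply]
  congr 1
  rw [Equiv.swap_apply_eq_iff, Equiv.swap_apply_left]

theorem reflect_swap (i j : Fin L) (k : ZMod n) :
    (reflect j i (-k) : Op n N L) = reflect i j k := by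
  simp only [reflect, neg_neg, Equiv.swap_comm j i, add_comm]

theorem act_mul_reflect (s : Equiv.Perm (Fin L)) (a : Fin L → ZMod n) {i j : Fin L}
    (hij : i ≠ j) (k : ZMod n) : (act s a * reflect i j k : Op n N L) =
      reflect (s i) (s j) (k + a j - a i) * act s a := by
  simp only [reflect, act_mul_act]
  congr 1
  · exact Equiv.mul_swap_eq_swap_mul s i j
  · ext m
    simp only [Pi.add_apply, Pi.single_apply, s.injective.eq_iff]
    by_cases hi : m = i
    · subst hi
      simp [hij]
      abel
    · by_cases hj : m = j
      · subst hj
        simp [hi]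
        abel
      · simp [hi, hj, Equiv.swap_apply_of_ne_of_ne]

theorem reflect_mul_branch (i j : Fin L) (k m : ZMod n) :
    (reflect i j k * branch j m : Op n N L) = branch i m * reflect i j k := by
  rw [reflect, act_mul_branch, Equiv.swap_apply_right]

theorem branch_mul_reflect {i j : Fin L} (h : i ≠ j) (k m : ZMod n) :
    (branch j m * reflect i j k : Op n N L) = branch i m * reflect i j (k + m) := by
  rw [branch_eq_act, act_mul_reflect _ _ h, ← branch_eq_act, ← reflect_mul_branch]
  simp [h]

theorem reflect_mul_reflect_sub {i j : Fin L} (h : i ≠ j) (k m : ZMod n) :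
    (reflect i j k * reflect i j (k - m) : Op n N L) = branch i (-m) * branch j m := by
  simp only [reflect, branch_eq_act, act_mul_act, Equiv.swap_mul_self, one_mul]
  congr 1
  ext x
  by_cases hi : x = i
  · subst hi
    simp [h]
    abel
  · by_cases hj : x = j
    · subst hj
      simp [h.symm]
    · simp [hi, hj, Equiv.swap_apply_of_ne_of_ne]

theorem reflect_mul_reflect_left {i j c : Fin L} (hij : i ≠ j) (hi : c ≠ i) (hj : c ≠ j)
    (k l : ZMod n) :
    (reflect i j k * reflect j c l : Op n N L) = reflect i c (k + l) * reflect i j k := by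
  rw [reflect, act_mul_reflect _ _ hj.symm, Equiv.swap_apply_right,
    Equiv.swap_apply_of_ne_of_ne hi hj]
  simp [hi, hj, hij.symm, add_comm]

theorem reflect_mul_reflect_right {i j c : Fin L} (hij : i ≠ j) (hi : c ≠ i) (hj : c ≠ j)
    (k l : ZMod n) :
    (reflect i j k * reflect c i l : Op n N L) = reflect c j (l + k) * reflect i j k := by
  rw [← reflect_swap c i l, ← reflect_swap i j k, reflect_mul_reflect_left hij.symm hj hi,
    ← neg_add_rev, reflect_swap c j]

theorem reflect_commute_of_disjoint {i j c d : Fin L} (hci : c ≠ i) (hcj : c ≠ j) (hdi : d ≠ i)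
    (hdj : d ≠ j) (hcd : c ≠ d) (k l : ZMod n) :
    Commute (reflect i j k : Op n N L) (reflect c d l) := by
  rw [commute_iff_eq, reflect, act_mul_reflect _ _ hcd, Equiv.swap_apply_of_ne_of_ne hci hcj,
    Equiv.swap_apply_of_ne_of_ne hdi hdj]
  simp [hci, hcj, hdi, hdj]

/-! ### Coefficients of the Dunkl operators -/

variable [NeZero n]

theorem mulBy_apply {n : ℕ} (f : (Fin L → ZMod n) → (Fin L → ℝ) → ℂ) (hf) (ψ : WaveFn n N L)
    (κ v t) : ((mulBy f hf : Op n N L) ψ).1 κ v t = f κ t * ψ.1 κ v t := rfl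

theorem invPos_apply (i : Fin L) (ψ : WaveFn n N L) (κ v t) :
    ((invPos i : Op n N L) ψ).1 κ v t = (pos i κ t)⁻¹ * ψ.1 κ v t := rfl

open Classical in
/-- Multiplication by `1 / (q i - τ ^ k * q j)` if `i ≠ j`, and zero if `i = j`, so that the sums
over `j ≠ i` in the Dunkl operators become sums over all `j`. -/
def weight (i j : Fin L) (k : ZMod n) : Op n N L :=
  if h : i ≠ j then invDiff h k else 0

theorem weight_self (i : Fin L) (k : ZMod n) : (weight i i k : Op n N L) = 0 := by
  simp [weight]

theorem weight_of_ne {i j : Fin L} (h : i ≠ j) (k : ZMod n) :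
    (weight i j k : Op n N L) = invDiff h k := by
  rw [weight, dif_pos h]

theorem weight_apply {i j : Fin L} (h : i ≠ j) (k : ZMod n) (ψ : WaveFn n N L) (κ v t) :
    ((weight i j k : Op n N L) ψ).1 κ v t =
      (pos i κ t - root k * pos j κ t)⁻¹ * ψ.1 κ v t := by
  rw [weight_of_ne h]
  rfl

theorem mulBy_commute {n : ℕ} (f g : (Fin L → ZMod n) → (Fin L → ℝ) → ℂ) (hf hg) :
    Commute (mulBy f hf : Op n N L) (mulBy g hg) := by
  refine op_ext fun ψ κ v t _ => ?_
  simp only [Module.End.mul_apply, mulBy_apply]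
  ring

theorem commute_weight_of_mulBy {X : Op n N L} (h : ∀ f hf, Commute X (mulBy f hf))
    (i j : Fin L) (k : ZMod n) : Commute X (weight i j k) := by
  by_cases hij : i = j
  · subst hij
    rw [weight_self]
    exact Commute.zero_right _
  · rw [weight_of_ne hij]
    exact h _ _

theorem weight_commute (i j c d : Fin L) (k l : ZMod n) :
    Commute (weight i j k : Op n N L) (weight c d l) :=
  commute_weight_of_mulBy (fun _ _ => (commute_weight_of_mulBy (fun _ _ =>
    mulBy_commute _ _ _ _) i j k).symm) c d l

theorem weight_commute_invPos (i j c : Fin L) (k : ZMod n) :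
    Commute (weight i j k : Op n N L) (invPos c) :=
  (commute_weight_of_mulBy (fun _ _ => mulBy_commute _ _ _ _) i j k).symm

theorem invPos_commute (i j : Fin L) : Commute (invPos i : Op n N L) (invPos j) :=
  mulBy_commute _ _ _ _

theorem weight_swap (i j : Fin L) (k : ZMod n) :
    (weight j i (-k) : Op n N L) = -(root k • (weight i j k : Op n N L)) := by
  by_cases h : i = j
  · simp [h, weight_self]
  refine op_ext fun ψ κ v t _ => ?_
  have hpos : pos j κ t - root (-k) * pos i κ t =
      -((root k)⁻¹ * (pos i κ t - root k * pos j κ t)) := by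
    rw [root_neg, mul_sub, inv_mul_cancel_left₀ (root_ne_zero k)]
    ring
  simp only [weight_apply (Ne.symm h), LinearMap.neg_apply, LinearMap.smul_apply,
    Submodule.coe_neg, Submodule.coe_smul, Pi.neg_apply, Pi.smul_apply, smul_eq_mul,
    weight_apply h, hpos, inv_neg, mul_inv, inv_inv, neg_mul, mul_assoc]

theorem weight_partial_fraction {i j : Fin L} (h : i ≠ j) (k : ZMod n) :
    root k • (weight i j k * invPos i : Op n N L) - weight i j k * invPos j =
      -(invPos i * invPos j) := by
  refine op_ext fun ψ κ v t ht => ?_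
  simp only [LinearMap.sub_apply, LinearMap.neg_apply, LinearMap.smul_apply, Submodule.coe_sub,
    Submodule.coe_neg, Submodule.coe_smul, Pi.neg_apply, Pi.smul_apply, Pi.sub_apply, smul_eq_mul,
    weight_apply h, Module.End.mul_apply, invPos_apply]
  have hij := pos_sub_ne_zero h k κ ht
  have hi := pos_ne_zero i κ ht
  have hj := pos_ne_zero j κ ht
  field_simp
  ring

theorem weight_mul_weight_triple {i j c : Fin L} (hij : i ≠ j) (hic : i ≠ c) (hjc : j ≠ c)
    (k l : ZMod n) : root k • (weight i j k * weight i c (k + l) : Op n N L) +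
      weight i c (k + l) * weight j c l = weight j c l * weight i j k := by
  refine op_ext fun ψ κ v t ht => ?_
  simp only [LinearMap.add_apply, LinearMap.smul_apply, Submodule.coe_add,
    Submodule.coe_smul, Pi.smul_apply, Pi.add_apply, smul_eq_mul,
    weight_apply hij, weight_apply hic, weight_apply hjc, Module.End.mul_apply]
  have h₁ := pos_sub_ne_zero hij k κ ht
  have h₂ := pos_sub_ne_zero hic (k + l) κ ht
  have h₃ := pos_sub_ne_zero hjc l κ ht
  rw [root_add] at h₂ ⊢
  field_simp
  ring

theorem weight_mul_weight_pair {i j : Fin L} (h : i ≠ j) (k l : ZMod n) :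
    root k • (weight i j k * weight i j l : Op n N L) -
      root l • (weight i j k * weight i j l : Op n N L) =
      invPos j * weight i j k - invPos j * weight i j l := by
  refine op_ext fun ψ κ v t ht => ?_
  simp only [LinearMap.sub_apply, LinearMap.smul_apply, Submodule.coe_sub,
    Submodule.coe_smul, Pi.smul_apply, Pi.sub_apply, smul_eq_mul,
    weight_apply h, Module.End.mul_apply, invPos_apply]
  have hk := pos_sub_ne_zero h k κ ht
  have hl := pos_sub_ne_zero h l κ ht
  have hj := pos_ne_zero j κ ht
  have hdiff : (pos i κ t - root l * pos j κ t) - (pos i κ t - root k * pos j κ t) =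
    (root k - root l) * pos j κ t := by ring
  generalize pos i κ t - root l * pos j κ t = b at *
  generalize pos i κ t - root k * pos j κ t = a at *
  field_simp
  linear_combination (-ψ.1 κ v t) * hdiff

theorem pos_act (s : Equiv.Perm (Fin L)) (a : Fin L → ZMod n) (i : Fin L) (κ t) :
    pos i (fun i => κ (s i) + a i) (fun i => t (s i)) = root (a i) * pos (s i) κ t := by
  simp only [pos, root_add]
  ring

theorem act_mul_weight (s : Equiv.Perm (Fin L)) (a : Fin L → ZMod n) (i j : Fin L)
    (k : ZMod n) : (act s a * weight i j k : Op n N L) =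
      (root (a i))⁻¹ • (weight (s i) (s j) (k + a j - a i) * act s a : Op n N L) := by
  by_cases h : i = j
  · simp [h, weight_self]
  refine op_ext fun ψ κ v t _ => ?_
  simp only [Module.End.mul_apply, act_apply, weight_apply h, LinearMap.smul_apply,
    Submodule.coe_smul, Pi.smul_apply, weight_apply (s.injective.ne h), smul_eq_mul, pos_act]
  rw [← mul_assoc (root (a i))⁻¹, ← mul_inv]
  congr 2
  have := root_ne_zero (a i)
  rw [root_sub, root_add]
  field_simp

theorem reflect_mul_weight_left {i j c : Fin L} (hij : i ≠ j) (hi : c ≠ i) (hj : c ≠ j)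
    (k l : ZMod n) :
    (reflect i j k * weight j c l : Op n N L) =
      root k • (weight i c (k + l) * reflect i j k : Op n N L) := by
  rw [reflect, act_mul_weight, Equiv.swap_apply_right, Equiv.swap_apply_of_ne_of_ne hi hj]
  simp [hi, hj, hij.symm, root_neg, add_comm]

theorem reflect_mul_weight_right {i j c : Fin L} (hij : i ≠ j) (hi : c ≠ i) (hj : c ≠ j)
    (k l : ZMod n) :
    (reflect i j k * weight c i l : Op n N L) = weight c j (l + k) * reflect i j k := by
  rw [reflect, act_mul_weight, Equiv.swap_apply_left, Equiv.swap_apply_of_ne_of_ne hi hj]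
  simp [hi, hj, hij, root_zero]

theorem reflect_mul_weight_swap {i j : Fin L} (h : i ≠ j) (k l : ZMod n) :
    (reflect i j k * weight j i l : Op n N L) =
      root k • (weight i j (k + k + l) * reflect i j k : Op n N L) := by
  rw [reflect, act_mul_weight, Equiv.swap_apply_right, Equiv.swap_apply_left]
  simp [h, h.symm, root_neg, add_comm, add_left_comm]

theorem weight_commute_reflect {i j c d : Fin L} (hci : c ≠ i) (hcj : c ≠ j) (hdi : d ≠ i)
    (hdj : d ≠ j) (k l : ZMod n) : Commute (weight i j k : Op n N L) (reflect c d l) := by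
  symm
  rw [commute_iff_eq, reflect, act_mul_weight, Equiv.swap_apply_of_ne_of_ne hci.symm hdi.symm,
    Equiv.swap_apply_of_ne_of_ne hcj.symm hdj.symm]
  simp [hci.symm, hcj.symm, hdi.symm, hdj.symm, root_zero]

theorem branch_commute_weight {i j c : Fin L} (hi : c ≠ i) (hj : c ≠ j) (k m : ZMod n) :
    Commute (branch c m : Op n N L) (weight i j k) := by
  rw [commute_iff_eq, branch_eq_act, act_mul_weight]
  simp [hi.symm, hj.symm, root_zero]

theorem branch_mul_weight {i j : Fin L} (h : i ≠ j) (k m : ZMod n) :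
    (branch j m * weight i j k : Op n N L) = weight i j (k + m) * branch j m := by
  rw [branch_eq_act, act_mul_weight]
  simp [h, root_zero]

/-! ### Covariant families of operators -/

/-- A family of operators, one for each particle, is covariant if the wreath product acts on it as
on the operators `∂ / ∂ q i`: permutations permute the family, and a rotation of `q i` by `τ ^ k`
multiplies its member `i` by `τ ^ k`. -/
def IsCovariant (X : Fin L → Op n N L) : Prop :=
  ∀ s a i, X (s i) * act s a = root (a i) • (act s a * X i)

namespace IsCovariant

variable {X Y : Fin L → Op n N L}

theorem add (hX : IsCovariant X) (hY : IsCovariant Y) : IsCovariant fun i => X i + Y i :=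
  fun s a i => by rw [add_mul, mul_add, smul_add, hX, hY]

theorem smul (c : ℂ) (hX : IsCovariant X) : IsCovariant fun i => c • X i :=
  fun s a i => by rw [smul_mul_assoc, hX, mul_smul_comm, smul_comm]

theorem sum {ι : Type*} {S : Finset ι} {X : ι → Fin L → Op n N L}
    (hX : ∀ b ∈ S, IsCovariant (X b)) : IsCovariant fun i => ∑ b ∈ S, X b i :=
  fun s a i => by
    simp only [Finset.sum_mul, Finset.mul_sum, Finset.smul_sum]
    exact Finset.sum_congr rfl fun b hb => hX b hb s a i

theorem mul_branch (hX : IsCovariant X) (k : ZMod n) : IsCovariant fun i => X i * branch i k :=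
  fun s a i => by
    rw [mul_assoc, ← act_mul_branch, ← mul_assoc, hX, smul_mul_assoc, mul_assoc]

theorem commute_act (hX : IsCovariant X) {s : Equiv.Perm (Fin L)} {a : Fin L → ZMod n}
    {i : Fin L} (hs : s i = i) (ha : a i = 0) : Commute (X i) (act s a) := by
  have h := hX s a i
  rwa [hs, ha, root_zero, one_smul] at h

theorem commute_branch (hX : IsCovariant X) {i j : Fin L} (h : i ≠ j) (k : ZMod n) :
    Commute (X i) (branch j k) := by
  rw [branch_eq_act]
  exact hX.commute_act rfl (Pi.single_eq_of_ne h _)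

theorem mul_branch_self (hX : IsCovariant X) (i : Fin L) (k : ZMod n) :
    X i * branch i k = root k • (branch i k * X i) := by
  simpa only [Equiv.Perm.one_apply, Pi.single_eq_same, ← branch_eq_act] using
    hX 1 (Pi.single i k) i

theorem mul_reflect (hX : IsCovariant X) {i j : Fin L} (h : i ≠ j) (k : ZMod n) :
    X j * reflect i j k = root k • (reflect i j k * X i) := by
  have hk : (Pi.single i k + Pi.single j (-k) : Fin L → ZMod n) i = k := by simp [h]
  have hX' := hX (Equiv.swap i j) (Pi.single i k + Pi.single j (-k)) i
  rwa [hk, Equiv.swap_apply_left] at hX'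

theorem reflect_mul (hX : IsCovariant X) {i j : Fin L} (h : i ≠ j) (k : ZMod n) :
    reflect i j k * X j = root k • (X i * reflect i j k) := by
  rw [← reflect_swap i j k, hX.mul_reflect h.symm, smul_smul, root_neg,
    mul_inv_cancel₀ (root_ne_zero k), one_smul]

theorem commute_reflect (hX : IsCovariant X) {i j l : Fin L} (hi : l ≠ i) (hj : l ≠ j)
    (k : ZMod n) : Commute (X l) (reflect i j k) :=
  hX.commute_act (Equiv.swap_apply_of_ne_of_ne hi hj) (by simp [hi, hj])

end IsCovariant

theorem isCovariant_invPos : IsCovariant (invPos : Fin L → Op n N L) := by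
  refine fun s a i => op_ext fun ψ κ v t _ => ?_
  simp only [Module.End.mul_apply, act_apply, invPos_apply, LinearMap.smul_apply,
    Submodule.coe_smul, Pi.smul_apply, smul_eq_mul, pos_act, mul_inv, mul_assoc,
    mul_inv_cancel_left₀ (root_ne_zero (a i))]

theorem momentum_apply (ℏ : ℝ) (i : Fin L) (ψ : WaveFn n N L) (κ v) {t} (ht : t ∈ regular L) :
    ((momentum ℏ i : Op n N L) ψ).1 κ v t =
      -Complex.I * (ℏ : ℂ) * root (-κ i) * fderiv ℝ (ψ.1 κ v) t (Pi.single i 1) :=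
  if_pos ht

theorem contDiffAt_wave {n : ℕ} (ψ : WaveFn n N L) (κ v) {t} (ht : t ∈ regular L) :
    ContDiffAt ℝ ∞ (ψ.1 κ v) t :=
  (ψ.2 κ v).1.contDiffAt ((isOpen_regular L).mem_nhds ht)

theorem differentiableAt_wave {n : ℕ} (ψ : WaveFn n N L) (κ v) {t} (ht : t ∈ regular L) :
    DifferentiableAt ℝ (ψ.1 κ v) t :=
  (contDiffAt_wave ψ κ v ht).differentiableAt (by simp)

theorem fderiv_act_apply {n : ℕ} (s : Equiv.Perm (Fin L)) (a : Fin L → ZMod n)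
    (ψ : WaveFn n N L) (κ v) {t} (ht : t ∈ regular L) (i : Fin L) :
    fderiv ℝ (((act s a : Op n N L) ψ).1 κ v) t (Pi.single (s i) 1) =
      fderiv ℝ (ψ.1 (fun i => κ (s i) + a i) v) (fun i => t (s i)) (Pi.single i 1) := by
  let P : (Fin L → ℝ) →L[ℝ] Fin L → ℝ := ContinuousLinearMap.pi fun m =>
    ContinuousLinearMap.proj (s m)
  have hP : P (Pi.single (s i) 1) = Pi.single i 1 := by
    ext m
    simp [P, Pi.single_apply]
  have hcomp : ((act s a : Op n N L) ψ).1 κ v = ψ.1 (fun i => κ (s i) + a i) v ∘ P := rfl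
  have hd : DifferentiableAt ℝ (ψ.1 (fun i => κ (s i) + a i) v) (P t) :=
    differentiableAt_wave ψ _ v ((comp_perm_mem_regular s).2 ht)
  rw [hcomp, fderiv_comp _ hd P.differentiableAt, ContinuousLinearMap.fderiv,
    ContinuousLinearMap.comp_apply, hP]
  rfl

theorem isCovariant_momentum (ℏ : ℝ) : IsCovariant (momentum ℏ : Fin L → Op n N L) := by
  refine fun s a i => op_ext fun ψ κ v t ht => ?_
  simp only [Module.End.mul_apply, act_apply, momentum_apply _ _ _ _ _ ht, LinearMap.smul_apply,
    Submodule.coe_smul, Pi.smul_apply, smul_eq_mul, fderiv_act_apply s a ψ κ v ht,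
    momentum_apply _ _ _ _ _ ((comp_perm_mem_regular s).2 ht), neg_add, root_add, root_neg (a i)]
  have := root_ne_zero (a i)
  field_simp

/-- The exchange part `∑ k, 1 / (q i - τ ^ k * q j) * Q i ^ (-k) * P (i j) * Q i ^ k` of the Dunkl
operators. -/
def exchange (i j : Fin L) : Op n N L := ∑ k : ZMod n, weight i j k * reflect i j k

theorem exchange_self (i : Fin L) : (exchange i i : Op n N L) = 0 := by
  simp [exchange, weight_self]

/-- The impurity part `∑ k, μ k / q i * Q i ^ k` of the Dunkl operators. -/
def impurity (μ : ZMod n → ℂ) (i : Fin L) : Op n N L :=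
  ∑ k : ZMod n, μ k • (invPos i * branch i k : Op n N L)

theorem dunkl_eq (ℏ : ℝ) (lam : ℂ) (μ : ZMod n → ℂ) (i : Fin L) :
    (dunkl ℏ lam μ i : Op n N L) =
      momentum ℏ i + lam • (∑ j, exchange i j : Op n N L) + impurity μ i := by
  have hsum : (∑ j, exchange i j : Op n N L) = ∑ j : {j : Fin L // i ≠ j}, exchange i j.1 := by
    rw [← Finset.sum_subtype (Finset.univ.filter (i ≠ ·)) (by simp) fun j =>
      (exchange i j : Op n N L)]
    refine (Finset.sum_subset (Finset.subset_univ _) fun j _ hj => ?_).symm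
    rw [show j = i by simpa [eq_comm] using hj, exchange_self]
  unfold dunkl impurity
  rw [hsum]
  congr 3
  refine Finset.sum_congr rfl fun j _ => Finset.sum_congr rfl fun k _ => ?_
  rw [branch_mul_posPerm_mul_branch, weight_of_ne j.2]

theorem exchange_mul_act (s : Equiv.Perm (Fin L)) (a : Fin L → ZMod n) (i j : Fin L) :
    (exchange (s i) (s j) * act s a : Op n N L) =
      root (a i) • (act s a * exchange i j : Op n N L) := by
  by_cases hij : i = j
  · simp [hij, exchange_self]
  simp only [exchange, Finset.mul_sum, Finset.sum_mul, Finset.smul_sum]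
  refine (Fintype.sum_equiv (Equiv.addRight (a j - a i)) _ _ fun k => ?_).symm
  rw [← mul_assoc, act_mul_weight, smul_mul_assoc, mul_assoc, act_mul_reflect s a hij, smul_smul,
    mul_inv_cancel₀ (root_ne_zero _), one_smul, ← mul_assoc, Equiv.coe_addRight, add_sub_assoc]

theorem isCovariant_sum_exchange :
    IsCovariant fun i => (∑ j, exchange i j : Op n N L) := by
  intro s a i
  beta_reduce
  rw [← Equiv.sum_comp s]
  simp only [Finset.mul_sum, Finset.sum_mul, exchange_mul_act, Finset.smul_sum]

theorem isCovariant_impurity (μ : ZMod n → ℂ) :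
    IsCovariant (impurity μ : Fin L → Op n N L) :=
  .sum fun k _ => (isCovariant_invPos.mul_branch k).smul (μ k)

theorem isCovariant_dunkl (ℏ : ℝ) (lam : ℂ) (μ : ZMod n → ℂ) :
    IsCovariant (dunkl ℏ lam μ : Fin L → Op n N L) := by
  rw [funext (dunkl_eq ℏ lam μ)]
  exact ((isCovariant_momentum ℏ).add (isCovariant_sum_exchange.smul lam)).add
    (isCovariant_impurity μ)

/-! ### Commutators with momenta -/

theorem hasFDerivAt_pos (i : Fin L) (κ : Fin L → ZMod n) (t : Fin L → ℝ) :
    HasFDerivAt (pos i κ) (root (κ i) • Complex.ofRealCLM.comp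
      (ContinuousLinearMap.proj (R := ℝ) (φ := fun _ : Fin L => ℝ) i)) t := by
  have h := (Complex.ofRealCLM.comp
    (ContinuousLinearMap.proj (R := ℝ) (φ := fun _ : Fin L => ℝ) i)).hasFDerivAt (x := t)
  exact h.const_mul (root (κ i))

/-- Multiplication by `q i`. -/
def position (i : Fin L) : Op n N L := mulBy (pos i) fun κ => (contDiff_pos i κ).contDiffOn

theorem position_apply (i : Fin L) (ψ : WaveFn n N L) (κ v t) :
    ((position i : Op n N L) ψ).1 κ v t = pos i κ t * ψ.1 κ v t := rfl

theorem lie_momentum_position (ℏ : ℝ) (l i : Fin L) :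
    ⁅(momentum ℏ l : Op n N L), (position i : Op n N L)⁆ =
      (if l = i then -Complex.I * (ℏ : ℂ) else 0) • (1 : Op n N L) := by
  refine op_ext fun ψ κ v t ht => ?_
  have hmul : ((position i : Op n N L) ψ).1 κ v = pos i κ * ψ.1 κ v := rfl
  have hroot : root (-κ i) * root (κ i) = 1 := by rw [← root_add, neg_add_cancel, root_zero]
  simp only [Ring.lie_def, LinearMap.sub_apply, Module.End.mul_apply, Submodule.coe_sub,
    Pi.sub_apply, LinearMap.smul_apply, Submodule.coe_smul, Pi.smul_apply, Module.End.one_apply,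
    position_apply, momentum_apply _ _ _ _ _ ht, hmul, smul_eq_mul,
    fderiv_mul (hasFDerivAt_pos i κ t).differentiableAt (differentiableAt_wave ψ κ v ht),
    (hasFDerivAt_pos i κ t).fderiv]
  by_cases h : l = i
  · subst h
    simp
    linear_combination (-Complex.I * ℏ * ψ.1 κ v t) * hroot
  · simp [h, Ne.symm h]
    ring

theorem lie_eq_of_mul_eq_one {A : Type*} [Ring A] {p x y : A} (hxy : x * y = 1)
    (hyx : y * x = 1) : ⁅p, y⁆ = -(y * ⁅p, x⁆ * y) := by
  simp only [Ring.lie_def, mul_sub, sub_mul, mul_assoc, hxy, mul_one]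
  simp only [← mul_assoc, hyx, one_mul]
  abel

theorem momentum_commute_invPos (ℏ : ℝ) {j l : Fin L} (hj : l ≠ j) :
    Commute (momentum ℏ l : Op n N L) (invPos j) := by
  have hxy : (position j * invPos j : Op n N L) = 1 := op_ext fun ψ κ v t ht => by
    simp [position_apply, invPos_apply, mul_inv_cancel_left₀ (pos_ne_zero j κ ht)]
  have hyx : (invPos j * position j : Op n N L) = 1 := by rw [← hxy]; exact mulBy_commute _ _ _ _
  rw [commute_iff_lie_eq, lie_eq_of_mul_eq_one hxy hyx, lie_momentum_position, if_neg hj]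
  simp

theorem lie_momentum_weight (ℏ : ℝ) {i j : Fin L} (h : i ≠ j) (l : Fin L) (k : ZMod n) :
    ⁅(momentum ℏ l : Op n N L), (weight i j k : Op n N L)⁆ =
      (Complex.I * (ℏ : ℂ) * ((if l = i then 1 else 0) - root k * if l = j then 1 else 0)) •
        (weight i j k * weight i j k : Op n N L) := by
  have hxy : ((position i - root k • (position j : Op n N L)) * weight i j k : Op n N L) = 1 :=
    op_ext fun ψ κ v t ht => by
      simp [position_apply, weight_apply h, ← mul_assoc, ← sub_mul,
        mul_inv_cancel₀ (pos_sub_ne_zero h k κ ht)]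
  have hyx : (weight i j k * (position i - root k • (position j : Op n N L)) : Op n N L) = 1 := by
    have hcomm (m : Fin L) : Commute (position m : Op n N L) (weight i j k) :=
      commute_weight_of_mulBy (fun _ _ => mulBy_commute _ _ _ _) i j k
    rw [← hxy]
    exact ((hcomm i).sub_left ((hcomm j).smul_left _)).eq.symm
  rw [lie_eq_of_mul_eq_one hxy hyx, lie_sub, lie_smul, lie_momentum_position,
    lie_momentum_position, smul_smul, ← sub_smul, mul_smul_comm, mul_one, smul_mul_assoc,
    ← neg_smul]
  congr 1
  split_ifs <;> ring

theorem momentum_commute_weight (ℏ : ℝ) {i j l : Fin L} (hi : l ≠ i) (hj : l ≠ j)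
    (k : ZMod n) : Commute (momentum ℏ l : Op n N L) (weight i j k) := by
  by_cases h : i = j
  · rw [h, weight_self]
    exact Commute.zero_right _
  · rw [commute_iff_lie_eq, lie_momentum_weight ℏ h, if_neg hi, if_neg hj]
    simp

theorem momentum_momentum_apply (ℏ : ℝ) (i j : Fin L) (ψ : WaveFn n N L) (κ v) {t}
    (ht : t ∈ regular L) :
    ((momentum ℏ i * momentum ℏ j : Op n N L) ψ).1 κ v t =
      (-Complex.I * (ℏ : ℂ) * root (-κ i)) * ((-Complex.I * (ℏ : ℂ) * root (-κ j)) *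
        fderiv ℝ (fderiv ℝ (ψ.1 κ v)) t (Pi.single i 1) (Pi.single j 1)) := by
  rw [Module.End.mul_apply, momentum_apply _ _ _ _ _ ht]
  congr 1
  have heq : ((momentum ℏ j : Op n N L) ψ).1 κ v =ᶠ[nhds t] fun t =>
      -Complex.I * (ℏ : ℂ) * root (-κ j) * fderiv ℝ (ψ.1 κ v) t (Pi.single j 1) := by
    filter_upwards [(isOpen_regular L).mem_nhds ht] with t ht
    exact momentum_apply _ _ _ _ _ ht
  have hd : DifferentiableAt ℝ (fderiv ℝ (ψ.1 κ v)) t :=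
    ((contDiffAt_wave ψ κ v ht).fderiv_right (m := ∞) (by simp)).differentiableAt (by simp)
  rw [heq.fderiv_eq, fderiv_const_mul (hd.clm_apply (differentiableAt_const _)),
    fderiv_clm_apply hd (differentiableAt_const _)]
  simp

theorem momentum_commute (ℏ : ℝ) (i j : Fin L) :
    Commute (momentum ℏ i : Op n N L) (momentum ℏ j) := by
  refine op_ext fun ψ κ v t ht => ?_
  have hsymm : IsSymmSndFDerivAt ℝ (ψ.1 κ v) t :=
    (contDiffAt_wave ψ κ v ht).isSymmSndFDerivAt (by
      simp only [minSmoothness_of_isRCLikeNormedField]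
      exact WithTop.coe_le_coe.2 (le_top : (2 : ℕ∞) ≤ ⊤))
  rw [momentum_momentum_apply _ _ _ _ _ _ ht, momentum_momentum_apply _ _ _ _ _ _ ht, hsymm.eq]
  ring

/-! ### Commutativity of the Dunkl operators -/

theorem mul_mul_mul_of_mul_eq_smul {A : Type*} [Ring A] [Algebra ℂ A] {w w' w'' r r' : A}
    {c : ℂ} (h : r * w' = c • (w'' * r)) : w * r * (w' * r') = c • (w * w'' * (r * r')) := by
  rw [mul_assoc, ← mul_assoc r, h, smul_mul_assoc, mul_smul_comm, mul_assoc w'', ← mul_assoc]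

theorem exchange_swap (i j : Fin L) :
    (exchange j i : Op n N L) =
      -∑ k : ZMod n, root k • (weight i j k * reflect i j k : Op n N L) := by
  rw [exchange, ← Equiv.sum_comp (Equiv.neg (ZMod n)), ← Finset.sum_neg_distrib]
  refine Finset.sum_congr rfl fun k _ => ?_
  rw [Equiv.neg_apply, weight_swap, reflect_swap, neg_mul, smul_mul_assoc]

theorem exchange_triple_term {i j c : Fin L} (hij : i ≠ j) (hic : i ≠ c) (hjc : j ≠ c)
    (k l : ZMod n) :
    (weight i j k * reflect i j k * (weight j c l * reflect j c l) : Op n N L) +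
      weight i c (k + l) * reflect i c (k + l) * (weight j i (-k) * reflect j i (-k)) =
      weight j c l * reflect j c l * (weight i c (k + l) * reflect i c (k + l)) := by
  have h₁ : (weight i j k * reflect i j k * (weight j c l * reflect j c l) : Op n N L) =
      root k • (weight i j k * weight i c (k + l) * (reflect i j k * reflect j c l) :
        Op n N L) :=
    mul_mul_mul_of_mul_eq_smul (reflect_mul_weight_left hij hic.symm hjc.symm k l)
  have h₂ : (weight i c (k + l) * reflect i c (k + l) * (weight j i (-k) * reflect j i (-k)) :
      Op n N L) = weight i c (k + l) * weight j c l * (reflect i j k * reflect j c l) := by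
    rw [reflect_swap, reflect_mul_reflect_left hij hic.symm hjc.symm, mul_assoc,
      ← mul_assoc (reflect _ _ _), reflect_mul_weight_right hic hij.symm hjc]
    simp only [mul_assoc, neg_add_cancel_left]
  have h₃ : (weight j c l * reflect j c l * (weight i c (k + l) * reflect i c (k + l)) :
      Op n N L) = weight j c l * weight i j k * (reflect i j k * reflect j c l) := by
    rw [← reflect_swap j c l, mul_assoc, ← mul_assoc (reflect _ _ _),
      reflect_mul_weight_right hjc.symm hic hij, add_neg_cancel_right, ← mul_assoc, ← mul_assoc,
      mul_assoc (_ * _), reflect_mul_reflect_right hjc.symm hic hij, add_neg_cancel_right]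
  rw [h₁, h₂, h₃, ← weight_mul_weight_triple hij hic hjc, add_mul, smul_mul_assoc]

theorem sum_weight_mul_reflect_add (i j : Fin L) (k : ZMod n) :
    ∑ l, weight i j (k + l) * reflect i j (k + l) = (exchange i j : Op n N L) :=
  Equiv.sum_comp (Equiv.addLeft k) fun l => (weight i j l * reflect i j l : Op n N L)

theorem exchange_triple {i j c : Fin L} (hij : i ≠ j) (hic : i ≠ c) (hjc : j ≠ c) :
    (exchange i j * exchange j c + exchange i c * exchange j i : Op n N L) =
      exchange j c * exchange i c := by
  have hji : (exchange j i : Op n N L) = ∑ k, weight j i (-k) * reflect j i (-k) :=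
    (Equiv.sum_comp (Equiv.neg (ZMod n)) fun k =>
      (weight j i k * reflect j i k : Op n N L)).symm
  calc (exchange i j * exchange j c + exchange i c * exchange j i : Op n N L)
  _ = ∑ k : ZMod n, ∑ l : ZMod n,
      (weight i j k * reflect i j k * (weight j c l * reflect j c l) +
        weight i c (k + l) * reflect i c (k + l) * (weight j i (-k) * reflect j i (-k)) :
        Op n N L) := by
    simp only [Finset.sum_add_distrib, ← Finset.sum_mul, ← Finset.mul_sum,
      sum_weight_mul_reflect_add, ← hji]
    rfl
  _ = exchange j c * exchange i c := by
    simp only [exchange_triple_term hij hic hjc]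
    rw [Finset.sum_comm]
    simp only [← Finset.mul_sum, add_comm _ (_ : ZMod n), sum_weight_mul_reflect_add,
      ← Finset.sum_mul]
    rfl

theorem exchange_mul_exchange_swap {i j : Fin L} (h : i ≠ j) :
    (exchange i j * exchange j i : Op n N L) = ∑ k : ZMod n, ∑ m : ZMod n,
      root k • (weight i j k * weight i j (k + m) * (branch i (-m) * branch j m) :
        Op n N L) := by
  simp only [exchange, Finset.sum_mul_sum]
  refine Finset.sum_congr rfl fun k _ => Fintype.sum_equiv (Equiv.addRight k) _ _ fun l => ?_
  have hw : (reflect i j k * weight j i l : Op n N L) = _ := reflect_mul_weight_swap h k l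
  have hr : (reflect i j k * reflect j i l : Op n N L) =
      branch i (-(l + k)) * branch j (l + k) := by
    rw [← reflect_mul_reflect_sub h k, sub_add_cancel_right, reflect_swap j i]
  simp only [mul_mul_mul_of_mul_eq_smul hw, hr, Equiv.coe_addRight, add_assoc, add_comm l]

theorem exchange_pair {i j : Fin L} (h : i ≠ j) :
    Commute (exchange i j : Op n N L) (exchange j i) := by
  have hji : (exchange j i * exchange i j : Op n N L) = ∑ k : ZMod n, ∑ m : ZMod n,
      root (k + m) • (weight i j k * weight i j (k + m) * (branch i (-m) * branch j m) :
        Op n N L) := by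
    rw [exchange_mul_exchange_swap h.symm, ← Equiv.sum_comp (Equiv.neg (ZMod n))]
    refine Finset.sum_congr rfl fun k _ => ?_
    rw [← Equiv.sum_comp (Equiv.neg (ZMod n))]
    refine Finset.sum_congr rfl fun m _ => ?_
    simp only [Equiv.neg_apply, ← neg_add, weight_swap, neg_neg]
    rw [(branch_commute j i m (-m)).eq, neg_mul_neg, smul_mul_smul_comm, smul_mul_assoc, smul_smul,
      root_neg, inv_mul_cancel_left₀ (root_ne_zero k)]
  have hterm (k m : ZMod n) :
      root k • (weight i j k * weight i j (k + m) * (branch i (-m) * branch j m) : Op n N L) -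
        root (k + m) • (weight i j k * weight i j (k + m) * (branch i (-m) * branch j m) :
          Op n N L) =
      (invPos j * weight i j k - invPos j * weight i j (k + m)) *
        (branch i (-m) * branch j m) := by
    rw [← weight_mul_weight_pair h, sub_mul, smul_mul_assoc, smul_mul_assoc]
  rw [commute_iff_eq, ← sub_eq_zero, exchange_mul_exchange_swap h, hji, ← Finset.sum_sub_distrib]
  simp only [← Finset.sum_sub_distrib, hterm]
  rw [Finset.sum_comm]
  refine Finset.sum_eq_zero fun m _ => ?_
  rw [← Finset.sum_mul, Finset.sum_sub_distrib, ← Equiv.sum_comp (Equiv.addRight m),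
    sub_eq_zero.2, zero_mul]
  rfl

theorem exchange_commute_of_disjoint {i j c d : Fin L} (hci : c ≠ i) (hcj : c ≠ j) (hdi : d ≠ i)
    (hdj : d ≠ j) : Commute (exchange i j : Op n N L) (exchange c d) := by
  by_cases hcd : c = d
  · rw [hcd, exchange_self]
    exact Commute.zero_right _
  exact Commute.sum_left _ _ _ fun k _ => Commute.sum_right _ _ _ fun l _ =>
    .mul_left
      (.mul_right (weight_commute i j c d k l) (weight_commute_reflect hci hcj hdi hdj k l))
      (.mul_right (.symm (weight_commute_reflect hci.symm hdi.symm hcj.symm hdj.symm l k))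
        (reflect_commute_of_disjoint hci hcj hdi hdj hcd k l))

theorem lie_exchange_sum_exchange {i j l : Fin L} (h : i ≠ j) (hl : l ≠ j) :
    ⁅(exchange i l : Op n N L), (∑ m, exchange j m : Op n N L)⁆ =
      -⁅(exchange i j : Op n N L), (exchange j l : Op n N L)⁆ := by
  by_cases hli : l = i
  · rw [hli, exchange_self, zero_lie, (exchange_pair (n := n) (N := N) h).lie_eq, neg_zero]
  have hother (m : Fin L) (hm : m ≠ i ∧ m ≠ l) :
      ⁅(exchange i l : Op n N L), (exchange j m : Op n N L)⁆ = 0 := by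
    by_cases hmj : m = j
    · rw [hmj, exchange_self, lie_zero]
    · exact commute_iff_lie_eq.1 (exchange_commute_of_disjoint h.symm hl.symm hm.1 hm.2)
  rw [lie_sum, Fintype.sum_eq_add i l (Ne.symm hli) hother]
  simp only [Ring.lie_def]
  rw [← exchange_triple h (Ne.symm hli) hl.symm, ← exchange_triple h.symm hl.symm (Ne.symm hli)]
  abel

theorem sum_exchange_commute {i j : Fin L} (h : i ≠ j) :
    Commute (∑ l, exchange i l : Op n N L) (∑ l, exchange j l) := by
  rw [commute_iff_lie_eq, sum_lie, ← Finset.add_sum_erase _ _ (Finset.mem_univ j),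
    Finset.sum_congr rfl fun l hl => lie_exchange_sum_exchange h (Finset.ne_of_mem_erase hl),
    Finset.sum_neg_distrib, ← lie_sum, ← lie_neg, ← lie_add,
    ← Finset.add_sum_erase Finset.univ (fun l => (exchange j l : Op n N L)) (Finset.mem_univ j),
    exchange_self, zero_add, add_neg_cancel, lie_zero]

theorem momentum_commute_exchange (ℏ : ℝ) {i j l : Fin L} (hi : l ≠ i) (hj : l ≠ j) :
    Commute (momentum ℏ l : Op n N L) (exchange i j) :=
  Commute.sum_right _ _ _ fun k _ => .mul_right (momentum_commute_weight ℏ hi hj k)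
    ((isCovariant_momentum ℏ).commute_reflect hi hj k)

theorem lie_momentum_exchange (ℏ : ℝ) {i j : Fin L} (h : i ≠ j) :
    ⁅(momentum ℏ j : Op n N L), (exchange i j : Op n N L)⁆ =
      -((Complex.I * ℏ) • ∑ k : ZMod n, root k •
          (weight i j k * weight i j k * reflect i j k : Op n N L) +
        exchange j i * momentum ℏ i + exchange i j * momentum ℏ j) := by
  have hterm (k : ZMod n) : (momentum ℏ j * (weight i j k * reflect i j k) : Op n N L) =
      root k • (weight i j k * reflect i j k * momentum ℏ i : Op n N L) -
        (Complex.I * ℏ) • root k • (weight i j k * weight i j k * reflect i j k : Op n N L) := by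
    have hw := lie_momentum_weight (N := N) ℏ h j k
    rw [if_neg h.symm, if_pos rfl, Ring.lie_def, sub_eq_iff_eq_add] at hw
    rw [← mul_assoc, hw, add_mul, mul_assoc _ (momentum ℏ j),
      (isCovariant_momentum ℏ).mul_reflect h, mul_smul_comm, smul_mul_assoc, smul_smul,
      ← mul_assoc, mul_one, zero_sub, mul_neg, neg_smul, neg_add_eq_sub]
  rw [Ring.lie_def, exchange_swap i j, neg_mul, Finset.sum_mul]
  nth_rw 1 [exchange]
  simp only [Finset.mul_sum, hterm, Finset.sum_sub_distrib, ← Finset.smul_sum, smul_mul_assoc]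
  abel

theorem lie_momentum_exchange_comm (ℏ : ℝ) {i j : Fin L} (h : i ≠ j) :
    ⁅(momentum ℏ i : Op n N L), (exchange j i : Op n N L)⁆ =
      ⁅(momentum ℏ j : Op n N L), (exchange i j : Op n N L)⁆ := by
  have hsum : ∑ k : ZMod n, root k • (weight j i k * weight j i k * reflect j i k : Op n N L) =
      ∑ k : ZMod n, root k • (weight i j k * weight i j k * reflect i j k : Op n N L) := by
    rw [← Equiv.sum_comp (Equiv.neg (ZMod n))]
    refine Finset.sum_congr rfl fun k _ => ?_
    rw [Equiv.neg_apply, weight_swap, reflect_swap, neg_mul_neg, smul_mul_smul_comm,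
      smul_mul_assoc, smul_smul, root_neg, inv_mul_cancel_left₀ (root_ne_zero k)]
  rw [lie_momentum_exchange ℏ h, lie_momentum_exchange ℏ h.symm, hsum, add_right_comm]

theorem lie_exchange_invPos_mul_branch {i j : Fin L} (h : i ≠ j) (m : ZMod n) :
    ⁅(exchange i j : Op n N L), (invPos j * branch j m : Op n N L)⁆ =
      -(invPos i * invPos j * ∑ k, (branch i m * reflect i j k : Op n N L)) := by
  have hleft : (exchange i j * (invPos j * branch j m) : Op n N L) =
      ∑ k, root k • (weight i j k * invPos i * (branch i m * reflect i j k) : Op n N L) := by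
    rw [exchange, Finset.sum_mul]
    refine Finset.sum_congr rfl fun k _ => ?_
    rw [mul_mul_mul_of_mul_eq_smul ((isCovariant_invPos (N := N)).reflect_mul h k),
      reflect_mul_branch]
  have hright : (invPos j * branch j m * exchange i j : Op n N L) =
      ∑ k, (weight i j k * invPos j * (branch i m * reflect i j k) : Op n N L) := by
    rw [exchange, Finset.mul_sum]
    refine Fintype.sum_equiv (Equiv.addRight m) _ _ fun k => ?_
    rw [Equiv.coe_addRight, ← branch_mul_reflect h, (weight_commute_invPos i j j _).eq, mul_assoc,
      ← mul_assoc (branch j m), branch_mul_weight h]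
    simp only [mul_assoc]
  rw [Ring.lie_def, hleft, hright, ← Finset.sum_sub_distrib, Finset.mul_sum,
    ← Finset.sum_neg_distrib]
  refine Finset.sum_congr rfl fun k _ => ?_
  rw [← smul_mul_assoc, ← sub_mul, weight_partial_fraction h, neg_mul]

theorem lie_exchange_impurity_comm (μ : ZMod n → ℂ) {i j : Fin L} (h : i ≠ j) :
    ⁅(exchange i j : Op n N L), (impurity μ j : Op n N L)⁆ =
      ⁅(exchange j i : Op n N L), (impurity μ i : Op n N L)⁆ := by
  simp only [impurity, lie_sum, lie_smul]
  refine Finset.sum_congr rfl fun m _ => congrArg _ ?_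
  have hsum : ∑ k, (branch j m * reflect j i k : Op n N L) =
      ∑ k, branch i m * reflect i j k :=
    Fintype.sum_equiv ((Equiv.neg _).trans (Equiv.addRight m)) _ _ fun k => by
      rw [← reflect_swap j i, branch_mul_reflect h]
      rfl
  rw [lie_exchange_invPos_mul_branch h, lie_exchange_invPos_mul_branch h.symm, hsum,
    (invPos_commute i j).eq]

theorem commute_impurity {X : Op n N L} {i : Fin L} (hpos : Commute X (invPos i))
    (hbranch : ∀ k, Commute X (branch i k)) (μ : ZMod n → ℂ) : Commute X (impurity μ i) :=
  Commute.sum_right _ _ _ fun k _ => Commute.smul_right (hpos.mul_right (hbranch k)) (μ k)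

theorem exchange_commute_impurity (μ : ZMod n → ℂ) {i j l : Fin L} (hi : l ≠ i) (hj : l ≠ j) :
    Commute (exchange i j : Op n N L) (impurity μ l) :=
  Commute.sum_left _ _ _ fun k _ => Commute.mul_left
    (commute_impurity (weight_commute_invPos i j l k)
      (fun m => Commute.symm (branch_commute_weight hi hj k m)) μ)
    (Commute.symm ((isCovariant_impurity μ).commute_reflect hi hj k))

theorem impurity_commute (μ : ZMod n → ℂ) {i j : Fin L} (h : i ≠ j) :
    Commute (impurity μ i : Op n N L) (impurity μ j) :=
  commute_impurity (Commute.symm (commute_impurity (invPos_commute j i)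
    (isCovariant_invPos.commute_branch h.symm) μ)) ((isCovariant_impurity μ).commute_branch h) μ

theorem momentum_commute_impurity (ℏ : ℝ) (μ : ZMod n → ℂ) {i j : Fin L} (h : i ≠ j) :
    Commute (momentum ℏ i : Op n N L) (impurity μ j) :=
  commute_impurity (momentum_commute_invPos ℏ h) ((isCovariant_momentum ℏ).commute_branch h) μ

theorem lie_momentum_sum_exchange (ℏ : ℝ) {i j : Fin L} (h : i ≠ j) :
    ⁅(momentum ℏ i : Op n N L), (∑ l, exchange j l : Op n N L)⁆ =
      ⁅(momentum ℏ i : Op n N L), (exchange j i : Op n N L)⁆ := by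
  rw [lie_sum]
  exact Fintype.sum_eq_single i fun l hl =>
    commute_iff_lie_eq.1 (momentum_commute_exchange ℏ h hl.symm)

theorem lie_sum_exchange_impurity (μ : ZMod n → ℂ) {i j : Fin L} (h : i ≠ j) :
    ⁅(∑ l, exchange i l : Op n N L), (impurity μ j : Op n N L)⁆ =
      ⁅(exchange i j : Op n N L), (impurity μ j : Op n N L)⁆ := by
  rw [sum_lie]
  exact Fintype.sum_eq_single j fun l hl =>
    commute_iff_lie_eq.1 (exchange_commute_impurity μ h.symm hl.symm)

theorem commute_add_smul_add {A : Type*} [Ring A] [Algebra ℂ A] {p p' x x' m m' : A} (c : ℂ)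
    (hp : Commute p p') (hx : Commute x x') (hm : Commute m m') (hpm : Commute p m')
    (hmp : Commute p' m) (hpx : ⁅p, x'⁆ = ⁅p', x⁆) (hxm : ⁅x, m'⁆ = ⁅x', m⁆) :
    Commute (p + c • x + m) (p' + c • x' + m') := by
  rw [Ring.lie_def, Ring.lie_def, sub_eq_iff_eq_add] at hpx hxm
  rw [commute_iff_eq]
  simp only [add_mul, mul_add, smul_mul_assoc, mul_smul_comm, hp.eq, hx.eq, hm.eq, hpm.eq,
    ← hmp.eq, hpx, hxm, smul_add, smul_sub]
  abel

theorem dunkl_commute (ℏ : ℝ) (lam : ℂ) (μ : ZMod n → ℂ) (i j : Fin L) :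
    Commute (dunkl ℏ lam μ i : Op n N L) (dunkl ℏ lam μ j) := by
  by_cases h : i = j
  · rw [h]
  rw [dunkl_eq, dunkl_eq]
  refine commute_add_smul_add lam (momentum_commute ℏ i j) (sum_exchange_commute h)
    (impurity_commute μ h) (momentum_commute_impurity ℏ μ h)
    (momentum_commute_impurity ℏ μ (Ne.symm h)) ?_ ?_
  · rw [lie_momentum_sum_exchange ℏ h, lie_momentum_sum_exchange ℏ (Ne.symm h),
      lie_momentum_exchange_comm ℏ h]
  · rw [lie_sum_exchange_impurity μ h, lie_sum_exchange_impurity μ (Ne.symm h),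
      lie_exchange_impurity_comm μ h]

/-! ### Spins and permutations of particles -/

section Spin

variable {n : ℕ}

theorem spin_apply (i : Fin L) (M : Matrix (Fin N) (Fin N) ℂ) (ψ : WaveFn n N L) (κ v t) :
    ((spin i M : Op n N L) ψ).1 κ v t = ∑ w, M (v i) w * ψ.1 κ (Function.update v i w) t := rfl

theorem spin_mul (i : Fin L) (M M' : Matrix (Fin N) (Fin N) ℂ) :
    (spin i (M * M') : Op n N L) = spin i M * spin i M' := by
  refine op_ext fun ψ κ v t _ => ?_
  simp only [Module.End.mul_apply, spin_apply, Function.update_self, Function.update_idem,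
    Matrix.mul_apply, Finset.sum_mul, Finset.mul_sum, mul_assoc]
  rw [Finset.sum_comm]

theorem spin_one (i : Fin L) : (spin i 1 : Op n N L) = 1 := by
  refine op_ext fun ψ κ v t _ => ?_
  simp [spin_apply, Matrix.one_apply]

theorem spin_add (i : Fin L) (M M' : Matrix (Fin N) (Fin N) ℂ) :
    (spin i (M + M') : Op n N L) = spin i M + spin i M' := by
  refine op_ext fun ψ κ v t _ => ?_
  simp [spin_apply, add_mul, Finset.sum_add_distrib]

theorem spin_smul (i : Fin L) (c : ℂ) (M : Matrix (Fin N) (Fin N) ℂ) :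
    (spin i (c • M) : Op n N L) = c • (spin i M : Op n N L) := by
  refine op_ext fun ψ κ v t _ => ?_
  simp [spin_apply, Finset.mul_sum, mul_assoc]

theorem spin_commute {i j : Fin L} (h : i ≠ j) (M M' : Matrix (Fin N) (Fin N) ℂ) :
    Commute (spin i M : Op n N L) (spin j M') := by
  refine op_ext fun ψ κ v t _ => ?_
  simp only [Module.End.mul_apply, spin_apply, Function.update_of_ne h,
    Function.update_of_ne h.symm, Finset.mul_sum]
  rw [Finset.sum_comm]
  refine Finset.sum_congr rfl fun w _ => Finset.sum_congr rfl fun w' _ => ?_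
  rw [Function.update_comm h, mul_left_comm]

theorem spinPerm_mul_spin (s : Equiv.Perm (Fin L)) (i : Fin L) (M : Matrix (Fin N) (Fin N) ℂ) :
    (spinPerm s * spin i M : Op n N L) = spin (s i) M * spinPerm s := by
  refine op_ext fun ψ κ v t _ => ?_
  have hupdate (w : Fin N) : Function.update (fun m => v (s m)) i w =
      fun m => Function.update v (s i) w (s m) := by
    funext m
    simp [Function.update_apply]
  change ∑ w, M (v (s i)) w * ψ.1 κ (Function.update (fun m => v (s m)) i w) t = _
  simp only [hupdate]
  rfl

theorem act_commute_spin (s : Equiv.Perm (Fin L)) (a : Fin L → ZMod n) (i : Fin L)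
    (M : Matrix (Fin N) (Fin N) ℂ) : Commute (act s a : Op n N L) (spin i M) := rfl

theorem act_commute_spinPerm (s s' : Equiv.Perm (Fin L)) (a : Fin L → ZMod n) :
    Commute (act s a : Op n N L) (spinPerm s') := rfl

theorem branch_commute_spin (i j : Fin L) (k : ZMod n) (M : Matrix (Fin N) (Fin N) ℂ) :
    Commute (branch i k : Op n N L) (spin j M) := rfl

theorem mulBy_commute_spin (f : (Fin L → ZMod n) → (Fin L → ℝ) → ℂ) (hf) (i : Fin L)
    (M : Matrix (Fin N) (Fin N) ℂ) : Commute (mulBy f hf : Op n N L) (spin i M) := by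
  refine op_ext fun ψ κ v t _ => ?_
  simp only [Module.End.mul_apply, spin_apply, mulBy_apply, Finset.mul_sum]
  exact Finset.sum_congr rfl fun w _ => mul_left_comm _ _ _

theorem mulBy_commute_spinPerm (f : (Fin L → ZMod n) → (Fin L → ℝ) → ℂ) (hf)
    (s : Equiv.Perm (Fin L)) : Commute (mulBy f hf : Op n N L) (spinPerm s) := rfl

end Spin

theorem momentum_commute_spin (ℏ : ℝ) (j i : Fin L) (M : Matrix (Fin N) (Fin N) ℂ) :
    Commute (momentum ℏ j : Op n N L) (spin i M) := by
  refine op_ext fun ψ κ v t ht => ?_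
  simp only [Module.End.mul_apply, spin_apply, momentum_apply _ _ _ _ _ ht]
  have hdiff (w : Fin N) := differentiableAt_wave ψ κ (Function.update v i w) ht
  have hspin : ((spin i M : Op n N L) ψ).1 κ v =
      fun t => ∑ w, M (v i) w * ψ.1 κ (Function.update v i w) t := rfl
  rw [hspin, fderiv_fun_sum fun w _ => (hdiff w).const_mul _]
  simp only [sum_apply, Finset.mul_sum]
  refine Finset.sum_congr rfl fun w _ => ?_
  rw [fderiv_const_mul (hdiff w), smul_apply, smul_eq_mul, mul_left_comm]

theorem momentum_commute_spinPerm (ℏ : ℝ) (j : Fin L) (s : Equiv.Perm (Fin L)) :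
    Commute (momentum ℏ j : Op n N L) (spinPerm s) := rfl

theorem dunkl_commute_of_commute (ℏ : ℝ) (lam : ℂ) (μ : ZMod n → ℂ) (i : Fin L) {X : Op n N L}
    (hmomentum : Commute (momentum ℏ i) X) (hmulBy : ∀ f hf, Commute (mulBy f hf) X)
    (hact : ∀ s a, Commute (act s a) X) : Commute (dunkl ℏ lam μ i) X := by
  have hweight (j k) : Commute (weight i j k) X :=
    (commute_weight_of_mulBy (fun f hf => (hmulBy f hf).symm) i j k).symm
  have hexchange (j) : Commute (exchange i j) X :=
    Commute.sum_left _ _ _ fun k _ => (hweight j k).mul_left (hact _ _)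
  have himpurity : Commute (impurity μ i) X := Commute.sum_left _ _ _ fun k _ =>
    ((hmulBy _ _).mul_left (branch_eq_act (N := N) i k ▸ hact _ _)).smul_left _
  rw [dunkl_eq]
  exact (hmomentum.add_left ((Commute.sum_left _ _ _ fun j _ => hexchange j).smul_left _)).add_left
    himpurity

theorem dunkl_commute_spin (ℏ : ℝ) (lam : ℂ) (μ : ZMod n → ℂ) (j i : Fin L)
    (M : Matrix (Fin N) (Fin N) ℂ) : Commute (dunkl ℏ lam μ j : Op n N L) (spin i M) :=
  dunkl_commute_of_commute ℏ lam μ j (momentum_commute_spin ℏ j i M)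
    (fun f hf => mulBy_commute_spin f hf i M) fun s a => act_commute_spin s a i M

theorem dunkl_commute_spinPerm (ℏ : ℝ) (lam : ℂ) (μ : ZMod n → ℂ) (j : Fin L)
    (s : Equiv.Perm (Fin L)) : Commute (dunkl ℏ lam μ j : Op n N L) (spinPerm s) :=
  dunkl_commute_of_commute ℏ lam μ j (momentum_commute_spinPerm ℏ j s)
    (fun f hf => mulBy_commute_spinPerm f hf s) fun s' a => act_commute_spinPerm s' s a

section ParticlePerm

variable {n : ℕ}

/-- The exchange `𝓟 s * P s` of whole particles, positions together with spins. -/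
def particlePerm (s : Equiv.Perm (Fin L)) : Op n N L := posPerm s * spinPerm s

theorem particlePerm_mul (s s' : Equiv.Perm (Fin L)) :
    (particlePerm (s * s') : Op n N L) = particlePerm s * particlePerm s' := rfl

theorem particlePerm_one : (particlePerm 1 : Op n N L) = 1 := rfl

theorem particlePerm_mul_spin (s : Equiv.Perm (Fin L)) (i : Fin L)
    (M : Matrix (Fin N) (Fin N) ℂ) :
    (particlePerm s * spin i M : Op n N L) = spin (s i) M * particlePerm s := by
  rw [particlePerm, mul_assoc, spinPerm_mul_spin, ← mul_assoc, posPerm_eq_act,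
    (act_commute_spin s 0 (s i) M).eq, mul_assoc]

theorem particlePerm_mul_branch (s : Equiv.Perm (Fin L)) (i : Fin L) (k : ZMod n) :
    (particlePerm s * branch i k : Op n N L) = branch (s i) k * particlePerm s := by
  have hspin : Commute (branch i k : Op n N L) (spinPerm s) :=
    branch_eq_act (N := N) i k ▸ act_commute_spinPerm 1 s _
  rw [particlePerm, mul_assoc, ← hspin.eq, ← mul_assoc, posPerm_eq_act, act_mul_branch, mul_assoc]

end ParticlePerm

theorem particlePerm_mul_dunkl (ℏ : ℝ) (lam : ℂ) (μ : ZMod n → ℂ) (s : Equiv.Perm (Fin L))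
    (i : Fin L) :
    (particlePerm s * dunkl ℏ lam μ i : Op n N L) = dunkl ℏ lam μ (s i) * particlePerm s := by
  have hact := isCovariant_dunkl (N := N) ℏ lam μ s 0 i
  rw [Pi.zero_apply, root_zero, one_smul] at hact
  rw [particlePerm, mul_assoc, ← (dunkl_commute_spinPerm ℏ lam μ i s).eq, ← mul_assoc,
    posPerm_eq_act, ← hact, mul_assoc]

section Gpow

variable {G : GL (Fin N) ℂ}

theorem gpow_natCast {n : ℕ} (hG : G ^ n = 1) (m : ℕ) :
    gpow G (m : ZMod n) = ((G ^ m : GL (Fin N) ℂ) : Matrix (Fin N) (Fin N) ℂ) := by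
  rw [gpow, ZMod.val_natCast, ← pow_eq_pow_mod m hG]

theorem gpow_zero {n : ℕ} (G : GL (Fin N) ℂ) : gpow G (0 : ZMod n) = 1 := by
  simp [gpow]

theorem gpow_one {n : ℕ} (hG : G ^ n = 1) :
    gpow G (1 : ZMod n) = (G : Matrix (Fin N) (Fin N) ℂ) := by
  simpa using gpow_natCast hG 1

theorem gpow_add (hG : G ^ n = 1) (k l : ZMod n) : gpow G (k + l) = gpow G k * gpow G l := by
  rw [← ZMod.natCast_zmod_val k, ← ZMod.natCast_zmod_val l, ← Nat.cast_add, gpow_natCast hG,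
    gpow_natCast hG, gpow_natCast hG, pow_add, Units.val_mul]

theorem gpow_neg_mul (hG : G ^ n = 1) (k : ZMod n) : gpow G (-k) * gpow G k = 1 := by
  rw [← gpow_add hG, neg_add_cancel, gpow_zero]

theorem gpow_mul_neg (hG : G ^ n = 1) (k : ZMod n) : gpow G k * gpow G (-k) = 1 := by
  rw [← gpow_add hG, add_neg_cancel, gpow_zero]

end Gpow

section QuasiParity

variable {n : ℕ}

/-- The quasi-parity operator `Q i ^ k * G i ^ (-k)`. -/
def quasiParity (G : GL (Fin N) ℂ) (i : Fin L) (k : ZMod n) : Op n N L :=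
  branch i k * spin i (gpow G (-k))

theorem quasiParity_commute (G : GL (Fin N) ℂ) {i j : Fin L} (h : i ≠ j) (k l : ZMod n) :
    Commute (quasiParity G i k : Op n N L) (quasiParity G j l) :=
  ((branch_commute (N := N) i j k l).mul_right (branch_commute_spin i j k _)).mul_left
    ((branch_commute_spin (n := n) (N := N) j i l _).symm.mul_right (spin_commute h _ _))

theorem particlePerm_mul_quasiParity (G : GL (Fin N) ℂ) (s : Equiv.Perm (Fin L)) (i : Fin L)
    (k : ZMod n) :
    (particlePerm s * quasiParity G i k : Op n N L) = quasiParity G (s i) k * particlePerm s := by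
  rw [quasiParity, ← mul_assoc, particlePerm_mul_branch, mul_assoc, particlePerm_mul_spin,
    ← mul_assoc, quasiParity]

end QuasiParity

theorem quasiParity_zero {n : ℕ} (G : GL (Fin N) ℂ) (i : Fin L) :
    (quasiParity G i (0 : ZMod n) : Op n N L) = 1 := by
  rw [quasiParity, neg_zero, gpow_zero, spin_one, branch_zero, one_mul]

theorem quasiParity_add {G : GL (Fin N) ℂ} (hG : G ^ n = 1) (i : Fin L) (k l : ZMod n) :
    (quasiParity G i (k + l) : Op n N L) = quasiParity G i k * quasiParity G i l := by
  rw [quasiParity, neg_add, gpow_add hG, branch_add, spin_mul]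
  exact (branch_commute_spin i i l (gpow G (-k))).mul_mul_mul_comm _ _

/-! ### The projector onto the physical states -/

section Projections

variable {V : Type*} [AddCommGroup V] [Module ℂ V]

theorem isProj_average {Γ : Type*} [Group Γ] [Fintype Γ] (ρ : Representation ℂ Γ V) :
    LinearMap.IsProj ρ.invariants ((Fintype.card Γ : ℂ)⁻¹ • ∑ g, ρ g) := by
  have : Invertible (Fintype.card Γ : ℂ) :=
    invertibleOfNonzero (Nat.cast_ne_zero.2 Fintype.card_ne_zero)
  convert ρ.isProj_averageMap
  simp [Representation.averageMap, GroupAlgebra.average, map_sum]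

theorem isProj_mul {p q : Submodule ℂ V} {f g : Module.End ℂ V} (hf : LinearMap.IsProj p f)
    (hg : LinearMap.IsProj q g) (hfg : Commute f g) : LinearMap.IsProj (p ⊓ q) (f * g) where
  map_mem x := ⟨hf.map_mem (g x), by rw [hfg.eq]; exact hg.map_mem (f x)⟩
  map_id x hx := by rw [Module.End.mul_apply, hg.map_id x hx.2, hf.map_id x hx.1]

theorem isProj_list_prod {ι : Type*} {p : ι → Submodule ℂ V} {f : ι → Module.End ℂ V}
    (hf : ∀ i, LinearMap.IsProj (p i) (f i)) (hcomm : ∀ i j, Commute (f i) (f j)) (l : List ι) :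
    LinearMap.IsProj (⨅ i ∈ l, p i) (l.map f).prod := by
  induction l with
  | nil => simpa using ⟨fun _ => trivial, fun _ _ => rfl⟩
  | cons i l ih =>
    simp only [List.map_cons, List.prod_cons, List.mem_cons, iInf_or, iInf_inf_eq,
      iInf_iInf_eq_left]
    refine isProj_mul (hf i) ih (Commute.list_prod_right _ _ fun g hg => ?_)
    obtain ⟨j, -, rfl⟩ := List.mem_map.1 hg
    exact hcomm i j

end Projections

section Statistics

variable {n : ℕ} {ε : ℂ}

theorem parity_swap {i j : Fin L} (h : i ≠ j) : parity (Equiv.swap i j) = 1 := by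
  simp [parity, Equiv.Perm.sign_swap h]

theorem pow_parity_mul (hε : ε * ε = 1) (s s' : Equiv.Perm (Fin L)) :
    ε ^ parity (s * s') = ε ^ parity s * ε ^ parity s' := by
  rcases Int.units_eq_one_or (Equiv.Perm.sign s) with h | h <;>
  rcases Int.units_eq_one_or (Equiv.Perm.sign s') with h' | h' <;>
  simp [parity, h, h', hε]

/-- The action `s ↦ ε ^ |s| * 𝓟 s * P s` of the symmetric group, whose invariants are the states
of exchange statistics `ε`. -/
def statRep (hε : ε * ε = 1) : Representation ℂ (Equiv.Perm (Fin L)) (WaveFn n N L) where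
  toFun s := ε ^ parity s • (particlePerm s : Op n N L)
  map_one' := by simp [parity, particlePerm_one]
  map_mul' s s' := by
    rw [particlePerm_mul, pow_parity_mul hε, smul_mul_smul_comm]

theorem isProj_statProj (hε : ε * ε = 1) :
    LinearMap.IsProj (statRep hε).invariants (statProj ε : Op n N L) := by
  convert isProj_average (statRep hε)
  rw [statProj, one_div, Fintype.card_perm, Fintype.card_fin]
  rfl

theorem mem_invariants_statRep (hε : ε * ε = 1) (ψ : WaveFn n N L) :
    ψ ∈ (statRep hε).invariants ↔ ∀ i j : Fin L, i ≠ j →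
      (spinPerm (Equiv.swap i j) * posPerm (Equiv.swap i j) : Op n N L) ψ = ε • ψ := by
  have hswap {i j : Fin L} (hij : i ≠ j) : statRep hε (Equiv.swap i j) =
      ε • (spinPerm (Equiv.swap i j) * posPerm (Equiv.swap i j) : Op n N L) := by
    change ε ^ parity (Equiv.swap i j) • (particlePerm (Equiv.swap i j) : Op n N L) = _
    rw [parity_swap hij, pow_one]
    rfl
  rw [Representation.mem_invariants]
  refine ⟨fun h i j hij => ?_, fun h s => ?_⟩
  · rw [← h (Equiv.swap i j), hswap hij, LinearMap.smul_apply, smul_smul, hε, one_smul,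
      ← LinearMap.smul_apply, ← hswap hij, h]
  · induction s using Equiv.Perm.swap_induction_on with
    | one => rw [map_one, Module.End.one_apply]
    | swap_mul s i j hij ih =>
      rw [map_mul, Module.End.mul_apply, ih, hswap hij, LinearMap.smul_apply, h i j hij, smul_smul,
        hε, one_smul]

theorem commute_statProj (ε : ℂ) {X : Op n N L} (h : ∀ s, Commute X (particlePerm s)) :
    Commute X (statProj ε) :=
  (Commute.sum_right _ _ _ fun s _ => (h s).smul_right _).smul_right _

end Statistics

section Parity

variable {G : GL (Fin N) ℂ}

/-- The action `k ↦ Q i ^ k * G i ^ (-k)` of `ℤ / n`. -/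
def parityRep (hG : G ^ n = 1) (i : Fin L) :
    Representation ℂ (Multiplicative (ZMod n)) (WaveFn n N L) where
  toFun k := quasiParity G i k.toAdd
  map_one' := quasiParity_zero G i
  map_mul' k l := quasiParity_add hG i k.toAdd l.toAdd

/-- The quasi-parity projector of the particle `i`. -/
def parityFactor (G : GL (Fin N) ℂ) (i : Fin L) : Op n N L :=
  (1 / (n : ℂ)) • ∑ k : ZMod n, (quasiParity G i k : Op n N L)

theorem isProj_parityFactor (hG : G ^ n = 1) (i : Fin L) :
    LinearMap.IsProj (parityRep hG i).invariants (parityFactor G i) := by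
  convert isProj_average (parityRep hG i)
  rw [parityFactor, one_div, Fintype.card_multiplicative, ZMod.card]
  exact congrArg _ (Fintype.sum_equiv Multiplicative.ofAdd _ _ fun _ => rfl)

theorem spin_mul_quasiParity_one (hG : G ^ n = 1) (i : Fin L) :
    (spin i (G : Matrix (Fin N) (Fin N) ℂ) * quasiParity G i 1 : Op n N L) = branch i 1 := by
  rw [quasiParity, (branch_commute_spin i i 1 _).eq, ← mul_assoc, ← spin_mul, ← gpow_one hG,
    gpow_mul_neg hG, spin_one, one_mul]

theorem spin_mul_spin_gpow_neg_one (hG : G ^ n = 1) (i : Fin L) :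
    (spin i (gpow G (-1 : ZMod n)) * spin i (G : Matrix (Fin N) (Fin N) ℂ) : Op n N L) = 1 := by
  rw [← spin_mul, ← gpow_one hG, gpow_neg_mul hG, spin_one]

theorem mem_invariants_parityRep (hG : G ^ n = 1) (i : Fin L) (ψ : WaveFn n N L) :
    ψ ∈ (parityRep hG i).invariants ↔
      (spin i (G : Matrix (Fin N) (Fin N) ℂ) : Op n N L) ψ = branch i 1 ψ := by
  rw [Representation.mem_invariants]
  refine ⟨fun h => ?_, fun h k => ?_⟩
  · rw [← spin_mul_quasiParity_one hG, Module.End.mul_apply]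
    exact congrArg _ (h (Multiplicative.ofAdd 1)).symm
  · have hone : parityRep hG i (Multiplicative.ofAdd 1) ψ = ψ := by
      change (quasiParity G i 1 : Op n N L) ψ = ψ
      rw [quasiParity, (branch_commute_spin i i 1 _).eq, Module.End.mul_apply, ← h,
        ← Module.End.mul_apply, spin_mul_spin_gpow_neg_one hG, Module.End.one_apply]
    have hk : k = Multiplicative.ofAdd 1 ^ k.toAdd.val := by
      rw [← ofAdd_nsmul, nsmul_one, ZMod.natCast_zmod_val, ofAdd_toAdd]
    rw [hk, map_pow]
    exact Function.IsFixedPt.iterate hone _ |> (Module.End.pow_apply _ _ _).trans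

theorem commute_parityFactor {i : Fin L} {X : Op n N L}
    (h : ∀ k, Commute X (quasiParity G i k)) : Commute X (parityFactor G i) :=
  (Commute.sum_right _ _ _ fun k _ => h k).smul_right _

theorem parityFactor_commute (G : GL (Fin N) ℂ) (i j : Fin L) :
    Commute (parityFactor G i : Op n N L) (parityFactor G j) := by
  by_cases h : i = j
  · rw [h]
  · exact commute_parityFactor fun k => (commute_parityFactor fun l =>
      quasiParity_commute G (Ne.symm h) k l).symm

theorem parityProj_eq (G : GL (Fin N) ℂ) :
    (parityProj G : Op n N L) = ((List.finRange L).map (parityFactor G)).prod := by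
  rw [← List.ofFn_eq_map]
  rfl

theorem isProj_parityProj (hG : G ^ n = 1) :
    LinearMap.IsProj (⨅ i, (parityRep hG i).invariants) (parityProj G : Op n N L) := by
  rw [parityProj_eq]
  simpa only [List.mem_finRange, iInf_pos] using
    isProj_list_prod (isProj_parityFactor hG) (parityFactor_commute G) (List.finRange L)

theorem commute_parityProj {X : Op n N L} (h : ∀ i k, Commute X (quasiParity G i k)) :
    Commute X (parityProj G) := by
  rw [parityProj_eq]
  refine Commute.list_prod_right _ _ fun Y hY => ?_
  obtain ⟨i, -, rfl⟩ := List.mem_map.1 hY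
  exact commute_parityFactor (h i)

theorem particlePerm_mul_parityFactor (G : GL (Fin N) ℂ) (s : Equiv.Perm (Fin L)) (i : Fin L) :
    (particlePerm s * parityFactor G i : Op n N L) = parityFactor G (s i) * particlePerm s := by
  simp only [parityFactor, mul_smul_comm, smul_mul_assoc, Finset.mul_sum, Finset.sum_mul,
    particlePerm_mul_quasiParity]

theorem semiconjBy_list_prod {M ι : Type*} [Monoid M] {x : M} {f g : ι → M}
    (h : ∀ i, SemiconjBy x (f i) (g i)) (l : List ι) :
    SemiconjBy x (l.map f).prod (l.map g).prod := by
  induction l with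
  | nil => exact SemiconjBy.one_right x
  | cons a l ih => simpa only [List.map_cons, List.prod_cons] using (h a).mul_right ih

theorem particlePerm_commute_parityProj (G : GL (Fin N) ℂ) (s : Equiv.Perm (Fin L)) :
    Commute (particlePerm s : Op n N L) (parityProj G) := by
  have hperm : ((List.finRange L).map fun i => (parityFactor G (s i) : Op n N L)).prod =
      ((List.finRange L).map (parityFactor G)).prod := by
    rw [← List.ofFn_eq_map, ← List.ofFn_eq_map]
    refine (Equiv.Perm.ofFn_comp_perm s (parityFactor G)).prod_eq' ?_
    refine List.pairwise_of_forall_mem_list fun a ha b hb => ?_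
    obtain ⟨i, rfl⟩ := (List.mem_ofFn' _ _).1 ha
    obtain ⟨j, rfl⟩ := (List.mem_ofFn' _ _).1 hb
    exact parityFactor_commute G _ _
  have hsemiconj := semiconjBy_list_prod (M := Op n N L)
    (particlePerm_mul_parityFactor G s) (List.finRange L)
  rw [hperm, ← parityProj_eq] at hsemiconj
  exact hsemiconj

end Parity

/-- The projector `Λ_P Λ_Q` onto the physical states. -/
def physProj (G : GL (Fin N) ℂ) (ε : ℂ) : Op n N L := statProj ε * parityProj G

theorem physical_eq {G : GL (Fin N) ℂ} (hG : G ^ n = 1) {ε : ℂ} (hε : ε * ε = 1) :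
    physical n L ε G = (statRep hε).invariants ⊓ ⨅ i, (parityRep hG i).invariants := by
  ext ψ
  rw [Submodule.mem_inf, Submodule.mem_iInf, mem_invariants_statRep]
  simp only [mem_invariants_parityRep]
  rfl

theorem isProj_physProj {G : GL (Fin N) ℂ} (hG : G ^ n = 1) {ε : ℂ} (hε : ε * ε = 1) :
    LinearMap.IsProj (physical n L ε G) (physProj G ε : Op n N L) := by
  rw [physical_eq hG hε]
  exact isProj_mul (isProj_statProj hε) (isProj_parityProj hG)
    (commute_statProj ε fun s => (particlePerm_commute_parityProj G s).symm).symm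

theorem commute_physProj (G : GL (Fin N) ℂ) (ε : ℂ) {X : Op n N L}
    (hperm : ∀ s, Commute X (particlePerm s)) (hparity : ∀ i k, Commute X (quasiParity G i k)) :
    Commute X (physProj G ε) :=
  (commute_statProj ε hperm).mul_right (commute_parityProj hparity)

/-! ### Representations of the loop algebras -/

section LieHom

variable {R ι A B : Type*} [CommRing R] [Fintype ι] [Ring A] [Algebra R A] [Ring B] [Algebra R B]

/-- The sum of a family of algebra homomorphisms whose images commute with each other. It is a
homomorphism of the commutator Lie algebras, although not of algebras. -/
def sumLieHom (f : ι → A →ₐ[R] B) (hf : ∀ i j, i ≠ j → ∀ a b, Commute (f i a) (f j b)) :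
    A →ₗ⁅R⁆ B :=
  { ∑ i, (f i).toLinearMap with
    map_lie' := fun {a b} => by
      change (∑ i, (f i).toLinearMap) ⁅a, b⁆ =
        ⁅(∑ i, (f i).toLinearMap) a, (∑ i, (f i).toLinearMap) b⁆
      simp only [LinearMap.sum_apply, AlgHom.toLinearMap_apply, sum_lie, lie_sum]
      refine Finset.sum_congr rfl fun i _ => ?_
      rw [Fintype.sum_eq_single i fun j hj => commute_iff_lie_eq.1 (hf j i hj a b),
        Ring.lie_def, Ring.lie_def, map_sub, map_mul, map_mul] }

theorem sumLieHom_apply (f : ι → A →ₐ[R] B) (hf) (a : A) : sumLieHom f hf a = ∑ i, f i a := by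
  change (∑ i, (f i).toLinearMap) a = _
  rw [LinearMap.sum_apply]
  rfl

/-- The homomorphism `x ↦ f x * e` of Lie algebras, for an idempotent `e` commuting with the image
of `f`. -/
def mulIdempotent {𝔤 : Type*} [LieRing 𝔤] [LieAlgebra R 𝔤] (f : 𝔤 →ₗ⁅R⁆ A) {e : A}
    (he : IsIdempotentElem e) (hcomm : ∀ x, Commute (f x) e) : 𝔤 →ₗ⁅R⁆ A :=
  { LinearMap.mulRight R e ∘ₗ (f : 𝔤 →ₗ[R] A) with
    map_lie' := fun {x y} => by
      change f ⁅x, y⁆ * e = ⁅f x * e, f y * e⁆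
      rw [LieHom.map_lie, Ring.lie_def, Ring.lie_def, (hcomm y).symm.mul_mul_mul_comm,
        (hcomm x).symm.mul_mul_mul_comm, he.eq, sub_mul] }

end LieHom

/-- The action of matrices on the spin of the particle `i`, as a homomorphism of rings. -/
def spinHom {n : ℕ} (i : Fin L) : Matrix (Fin N) (Fin N) ℂ →+* Op n N L where
  toFun := spin i
  map_one' := spin_one i
  map_mul' := spin_mul i
  map_zero' := by simpa using spin_smul (n := n) i 0 (0 : Matrix (Fin N) (Fin N) ℂ)
  map_add' := spin_add i

/-- The action `Y(z) ↦ Y(d i)` on the spin of the particle `i`. -/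
def particleEval (ℏ : ℝ) (lam : ℂ) (μ : ZMod n → ℂ) (i : Fin L) :
    Matrix (Fin N) (Fin N) (Polynomial ℂ) →ₐ[ℂ] Op n N L :=
  { (Polynomial.eval₂RingHom' (spinHom i) (dunkl ℏ lam μ i) fun M =>
      (dunkl_commute_spin ℏ lam μ i i M).symm).comp
      (matPolyEquiv : Matrix (Fin N) (Fin N) (Polynomial ℂ) ≃ₐ[ℂ] _).toRingEquiv.toRingHom with
    commutes' := fun c => by
      have hC : matPolyEquiv (algebraMap ℂ (Matrix (Fin N) (Fin N) (Polynomial ℂ)) c) =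
          Polynomial.C (algebraMap ℂ (Matrix (Fin N) (Fin N) ℂ) c) := by
        rw [AlgEquiv.commutes]
        rfl
      change Polynomial.eval₂ (spinHom i) (dunkl ℏ lam μ i) (matPolyEquiv _) = _
      rw [hC, Polynomial.eval₂_C, Algebra.algebraMap_eq_smul_one, Algebra.algebraMap_eq_smul_one]
      exact (spin_smul i c 1).trans (by rw [spin_one]) }

theorem particleEval_eq_sum (ℏ : ℝ) (lam : ℂ) (μ : ZMod n → ℂ) (i : Fin L)
    (Y : Matrix (Fin N) (Fin N) (Polynomial ℂ)) :
    (particleEval ℏ lam μ i Y : Op n N L) = ∑ p ∈ (matPolyEquiv Y).support,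
      spin i ((matPolyEquiv Y).coeff p) * dunkl ℏ lam μ i ^ p :=
  Polynomial.eval₂_eq_sum

theorem particleEval_commute (ℏ : ℝ) (lam : ℂ) (μ : ZMod n → ℂ) (i j : Fin L) (h : i ≠ j)
    (Y Z : Matrix (Fin N) (Fin N) (Polynomial ℂ)) :
    Commute (particleEval ℏ lam μ i Y : Op n N L) (particleEval ℏ lam μ j Z) := by
  rw [particleEval_eq_sum, particleEval_eq_sum]
  refine Commute.sum_left _ _ _ fun p _ => Commute.sum_right _ _ _ fun q _ => ?_
  refine Commute.mul_left ?_ ?_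
  · exact Commute.mul_right (spin_commute h _ _)
      (Commute.pow_right (Commute.symm (dunkl_commute_spin ℏ lam μ j i _)) q)
  · exact Commute.mul_right (Commute.pow_left (dunkl_commute_spin ℏ lam μ i j _) p)
      (Commute.pow_pow (dunkl_commute ℏ lam μ i j) p q)

/-- The representation `Y(z) ↦ ∑ i, Y(d i)` of `gl_N[z]`. -/
def loopRep (ℏ : ℝ) (lam : ℂ) (μ : ZMod n → ℂ) :
    Matrix (Fin N) (Fin N) (Polynomial ℂ) →ₗ⁅ℂ⁆ Op n N L :=
  sumLieHom (particleEval ℏ lam μ) (particleEval_commute ℏ lam μ)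

theorem loopRep_apply (ℏ : ℝ) (lam : ℂ) (μ : ZMod n → ℂ)
    (Y : Matrix (Fin N) (Fin N) (Polynomial ℂ)) :
    (loopRep ℏ lam μ Y : Op n N L) = ∑ i, particleEval ℏ lam μ i Y :=
  sumLieHom_apply _ _ Y

theorem loopRep_commute_particlePerm (ℏ : ℝ) (lam : ℂ) (μ : ZMod n → ℂ)
    (Y : Matrix (Fin N) (Fin N) (Polynomial ℂ)) (s : Equiv.Perm (Fin L)) :
    Commute (loopRep ℏ lam μ Y : Op n N L) (particlePerm s) := by
  have heval (i : Fin L) : SemiconjBy (particlePerm s : Op n N L) (particleEval ℏ lam μ i Y)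
      (particleEval ℏ lam μ (s i) Y) := by
    rw [particleEval_eq_sum, particleEval_eq_sum, SemiconjBy, Finset.mul_sum, Finset.sum_mul]
    refine Finset.sum_congr rfl fun p _ => ?_
    have hspin : SemiconjBy (particlePerm s : Op n N L) (spin i ((matPolyEquiv Y).coeff p))
        (spin (s i) ((matPolyEquiv Y).coeff p)) := particlePerm_mul_spin s i _
    have hdunkl : SemiconjBy (particlePerm s : Op n N L) (dunkl ℏ lam μ i) (dunkl ℏ lam μ (s i)) :=
      particlePerm_mul_dunkl ℏ lam μ s i
    exact hspin.mul_right (hdunkl.pow_right p)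
  refine Commute.symm ?_
  rw [commute_iff_eq, loopRep_apply, Finset.mul_sum, Finset.sum_mul]
  exact Fintype.sum_equiv s _ _ heval

section Twisted

variable {G : GL (Fin N) ℂ}

theorem gpow_neg_one (hG : G ^ n = 1) :
    gpow G (-1 : ZMod n) = ((G⁻¹ : GL (Fin N) ℂ) : Matrix (Fin N) (Fin N) ℂ) :=
  left_inv_eq_right_inv (gpow_one hG ▸ gpow_neg_mul hG 1) G.mul_inv

/-- The automorphism `σ ^ k : M ↦ G ^ (-k) * M * G ^ k` of the algebra of matrices. -/
def conj (hG : G ^ n = 1) (k : ZMod n) :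
    Matrix (Fin N) (Fin N) ℂ →ₐ[ℂ] Matrix (Fin N) (Fin N) ℂ :=
  AlgHom.ofLinearMap (LinearMap.mulLeftRight ℂ (gpow G (-k), gpow G k))
    (by rw [LinearMap.mulLeftRight_apply, mul_one, gpow_neg_mul hG]) fun M M' => by
      simp only [LinearMap.mulLeftRight_apply]
      simp only [mul_assoc]
      rw [← mul_assoc (gpow G k) (gpow G (-k)), gpow_mul_neg hG, one_mul]

theorem conj_apply (hG : G ^ n = 1) (k : ZMod n) (M : Matrix (Fin N) (Fin N) ℂ) :
    conj hG k M = gpow G (-k) * M * gpow G k := rfl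

theorem conj_zero (hG : G ^ n = 1) (M : Matrix (Fin N) (Fin N) ℂ) : conj hG 0 M = M := by
  rw [conj_apply, neg_zero, gpow_zero, one_mul, mul_one]

theorem conj_add (hG : G ^ n = 1) (k l : ZMod n) (M : Matrix (Fin N) (Fin N) ℂ) :
    conj hG (k + l) M = conj hG k (conj hG l M) := by
  simp only [conj_apply, mul_assoc]
  rw [neg_add, gpow_add hG, add_comm, gpow_add hG]
  simp only [mul_assoc]

theorem conj_lie (hG : G ^ n = 1) (k : ZMod n) (M M' : Matrix (Fin N) (Fin N) ℂ) :
    conj hG k ⁅M, M'⁆ = ⁅conj hG k M, conj hG k M'⁆ := by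
  rw [Ring.lie_def, Ring.lie_def, map_sub, map_mul, map_mul]

theorem coeff_sigma (hG : G ^ n = 1) (Y : Matrix (Fin N) (Fin N) (Polynomial ℂ)) (p : ℕ) :
    (matPolyEquiv (sigma G Y)).coeff p = conj hG 1 ((matPolyEquiv Y).coeff p) := by
  rw [sigma, map_mul, map_mul, matPolyEquiv_map_C, matPolyEquiv_map_C, Polynomial.coeff_mul_C,
    Polynomial.coeff_C_mul, conj_apply, gpow_neg_one hG, gpow_one hG]

theorem coeff_rotate (Y : Matrix (Fin N) (Fin N) (Polynomial ℂ)) (p : ℕ) :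
    (matPolyEquiv (rotate n Y)).coeff p = root (1 : ZMod n) ^ p • (matPolyEquiv Y).coeff p := by
  ext i j
  rw [matPolyEquiv_coeff_apply, rotate, Matrix.map_apply, Polynomial.comp_C_mul_X_coeff,
    Matrix.smul_apply, matPolyEquiv_coeff_apply, smul_eq_mul, mul_comm]

theorem mem_twistedLoop_iff (hG : G ^ n = 1) (Y : Matrix (Fin N) (Fin N) (Polynomial ℂ)) :
    Y ∈ twistedLoop n G ↔ ∀ p,
      conj hG 1 ((matPolyEquiv Y).coeff p) = root (1 : ZMod n) ^ p • (matPolyEquiv Y).coeff p := by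
  change sigma G Y = rotate n Y ↔ _
  simp only [← matPolyEquiv.injective.eq_iff, Polynomial.ext_iff, coeff_sigma hG, coeff_rotate]

theorem conj_eq_smul (hG : G ^ n = 1) {M : Matrix (Fin N) (Fin N) ℂ} {p : ℕ}
    (h : conj hG 1 M = root (1 : ZMod n) ^ p • M) (k : ZMod n) :
    conj hG k M = root k ^ p • M := by
  rw [← ZMod.natCast_zmod_val k]
  generalize k.val = m
  induction m with
  | zero => rw [Nat.cast_zero, conj_zero, root_zero, one_pow, one_smul]
  | succ m ih =>
    rw [Nat.cast_succ, conj_add, h, map_smul, ih, smul_smul, ← mul_pow, ← root_add, add_comm]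

theorem spin_mul_quasiParity (hG : G ^ n = 1) (i : Fin L) (k : ZMod n)
    (M : Matrix (Fin N) (Fin N) ℂ) :
    (spin i M * quasiParity G i k : Op n N L) = quasiParity G i k * spin i (conj hG (-k) M) := by
  rw [quasiParity, ← mul_assoc, ← (branch_commute_spin i i k M).eq, mul_assoc, mul_assoc,
    ← spin_mul, ← spin_mul, conj_apply, neg_neg, ← mul_assoc, ← mul_assoc, gpow_neg_mul hG,
    one_mul]

theorem dunkl_mul_quasiParity (ℏ : ℝ) (lam : ℂ) (μ : ZMod n → ℂ) (G : GL (Fin N) ℂ) (i : Fin L)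
    (k : ZMod n) : (dunkl ℏ lam μ i * quasiParity G i k : Op n N L) =
      root k • (quasiParity G i k * dunkl ℏ lam μ i : Op n N L) := by
  rw [quasiParity, ← mul_assoc, (isCovariant_dunkl ℏ lam μ).mul_branch_self, smul_mul_assoc,
    mul_assoc, mul_assoc, (dunkl_commute_spin ℏ lam μ i i _).eq]

theorem dunkl_pow_mul_quasiParity (ℏ : ℝ) (lam : ℂ) (μ : ZMod n → ℂ) (G : GL (Fin N) ℂ)
    (i : Fin L) (k : ZMod n) (p : ℕ) : (dunkl ℏ lam μ i ^ p * quasiParity G i k : Op n N L) =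
      root k ^ p • (quasiParity G i k * dunkl ℏ lam μ i ^ p : Op n N L) := by
  have hsemiconj : SemiconjBy (quasiParity G i k : Op n N L)
      (root k • (dunkl ℏ lam μ i : Op n N L)) (dunkl ℏ lam μ i) := by
    rw [SemiconjBy, mul_smul_comm, dunkl_mul_quasiParity]
  rw [← (hsemiconj.pow_right p).eq, smul_pow, mul_smul_comm]

theorem particleEval_commute_quasiParity (ℏ : ℝ) (lam : ℂ) (μ : ZMod n → ℂ) (hG : G ^ n = 1)
    {Y : Matrix (Fin N) (Fin N) (Polynomial ℂ)} (hY : Y ∈ twistedLoop n G) (j i : Fin L)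
    (k : ZMod n) : Commute (particleEval ℏ lam μ j Y : Op n N L) (quasiParity G i k) := by
  rw [particleEval_eq_sum]
  refine Commute.sum_left _ _ _ fun p _ => ?_
  by_cases hji : j = i
  · subst hji
    rw [commute_iff_eq, mul_assoc, dunkl_pow_mul_quasiParity, mul_smul_comm, ← mul_assoc,
      spin_mul_quasiParity hG, conj_eq_smul hG ((mem_twistedLoop_iff hG Y).1 hY p), spin_smul,
      mul_smul_comm, smul_mul_assoc, smul_smul, ← mul_pow, ← root_add, add_neg_cancel, root_zero,
      one_pow, one_smul, mul_assoc]
  · refine Commute.mul_left ?_ (Commute.pow_left ?_ p)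
    · exact Commute.mul_right (Commute.symm (branch_commute_spin i j k _)) (spin_commute hji _ _)
    · exact Commute.mul_right ((isCovariant_dunkl ℏ lam μ).commute_branch hji k)
        (dunkl_commute_spin ℏ lam μ j i _)

theorem loopRep_commute_physProj (ℏ : ℝ) (lam : ℂ) (μ : ZMod n → ℂ) (hG : G ^ n = 1) (ε : ℂ)
    {Y : Matrix (Fin N) (Fin N) (Polynomial ℂ)} (hY : Y ∈ twistedLoop n G) :
    Commute (loopRep ℏ lam μ Y : Op n N L) (physProj G ε) := by
  refine commute_physProj G ε (loopRep_commute_particlePerm ℏ lam μ Y) fun i k => ?_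
  rw [loopRep_apply]
  exact Commute.sum_left _ _ _ fun j _ => particleEval_commute_quasiParity ℏ lam μ hG hY j i k

/-- The representation `Y(z) ↦ (∑ i, Y(d i)) Λ_P Λ_Q` of `gl_N[z]^σ`. -/
def twistedRep (ℏ : ℝ) (lam : ℂ) (μ : ZMod n → ℂ) (hG : G ^ n = 1) {ε : ℂ} (hε : ε * ε = 1) :
    twistedLoop n G →ₗ⁅ℂ⁆ Op n N L :=
  mulIdempotent ((loopRep ℏ lam μ).comp (twistedLoop n G).incl)
    (isProj_physProj hG hε).isIdempotentElem fun Y => loopRep_commute_physProj ℏ lam μ hG ε Y.2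

theorem twistedRep_apply (ℏ : ℝ) (lam : ℂ) (μ : ZMod n → ℂ) (hG : G ^ n = 1) {ε : ℂ}
    (hε : ε * ε = 1) (Y : twistedLoop n G) :
    (twistedRep ℏ lam μ hG hε Y : Op n N L) = loopRep ℏ lam μ Y.1 * physProj G ε := rfl

theorem twistedRep_mem_physical (ℏ : ℝ) (lam : ℂ) (μ : ZMod n → ℂ) (hG : G ^ n = 1) {ε : ℂ}
    (hε : ε * ε = 1) (Y : twistedLoop n G) (ψ : WaveFn n N L) :
    (twistedRep ℏ lam μ hG hε Y : Op n N L) ψ ∈ physical n L ε G := by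
  rw [twistedRep_apply, (loopRep_commute_physProj ℏ lam μ hG ε Y.2).eq, Module.End.mul_apply]
  exact (isProj_physProj hG hε).map_mem _

end Twisted

/-! ### Generators of the twisted loop algebra -/

/-- The linear map `M ↦ M z ^ p`. -/
def monoMat (p : ℕ) :
    Matrix (Fin N) (Fin N) ℂ →ₗ[ℂ] Matrix (Fin N) (Fin N) (Polynomial ℂ) :=
  (Polynomial.monomial p).mapMatrix

theorem matPolyEquiv_monoMat (p : ℕ) (M : Matrix (Fin N) (Fin N) ℂ) :
    matPolyEquiv (monoMat p M) = Polynomial.monomial p M := by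
  ext m i j
  rw [matPolyEquiv_coeff_apply, monoMat, LinearMap.mapMatrix_apply, Matrix.map_apply,
    Polynomial.coeff_monomial, Polynomial.coeff_monomial]
  split_ifs <;> simp

theorem monoMat_mul (p q : ℕ) (M M' : Matrix (Fin N) (Fin N) ℂ) :
    monoMat p M * monoMat q M' = monoMat (p + q) (M * M') := by
  apply matPolyEquiv.injective
  rw [map_mul, matPolyEquiv_monoMat, matPolyEquiv_monoMat, matPolyEquiv_monoMat,
    Polynomial.monomial_mul_monomial]

theorem monoMat_lie (p q : ℕ) (M M' : Matrix (Fin N) (Fin N) ℂ) :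
    ⁅monoMat p M, monoMat q M'⁆ = monoMat (p + q) ⁅M, M'⁆ := by
  rw [Ring.lie_def, Ring.lie_def, monoMat_mul, monoMat_mul, add_comm q p, map_sub]

theorem monoMat_one_commute (p : ℕ) (Y : Matrix (Fin N) (Fin N) (Polynomial ℂ)) :
    Commute (monoMat p 1) Y := by
  apply matPolyEquiv.injective
  rw [map_mul, map_mul, matPolyEquiv_monoMat, Polynomial.monomial_one_right_eq_X_pow]
  exact (Polynomial.commute_X_pow _ p).eq

theorem loopRep_monoMat (ℏ : ℝ) (lam : ℂ) (μ : ZMod n → ℂ) (p : ℕ)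
    (M : Matrix (Fin N) (Fin N) ℂ) :
    (loopRep ℏ lam μ (monoMat p M) : Op n N L) = ∑ i, spin i M * dunkl ℏ lam μ i ^ p := by
  refine (loopRep_apply ℏ lam μ _).trans (Finset.sum_congr rfl fun i _ => ?_)
  change Polynomial.eval₂ (spinHom i) (dunkl ℏ lam μ i) (matPolyEquiv (monoMat p M)) = _
  rw [matPolyEquiv_monoMat, Polynomial.eval₂_monomial]
  rfl

theorem root_natCast_mul (m : ℕ) (k : ZMod n) : root ((m : ZMod n) * k) = root k ^ m := by
  rw [← nsmul_eq_mul]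
  exact AddChar.map_nsmul_eq_pow _ m k

section Generators

variable {G : GL (Fin N) ℂ}

/-- `n` times the projection `M ↦ n⁻¹ * ∑ k, τ ^ (-p k) σ ^ k (M)` onto the eigenspace of `σ` of
eigenvalue `τ ^ p`, which consists of the `M` with `M z ^ p` in `gl_N[z]^σ`. -/
def twistAverage (hG : G ^ n = 1) (p : ℕ) :
    Matrix (Fin N) (Fin N) ℂ →ₗ[ℂ] Matrix (Fin N) (Fin N) ℂ :=
  ∑ k : ZMod n, root (-((p : ZMod n) * k)) • (conj hG k).toLinearMap

theorem twistAverage_apply (hG : G ^ n = 1) (p : ℕ) (M : Matrix (Fin N) (Fin N) ℂ) :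
    twistAverage hG p M = ∑ k : ZMod n, root (-((p : ZMod n) * k)) • conj hG k M := by
  simp [twistAverage]

theorem root_pow_mul_root_neg (p : ℕ) (k l : ZMod n) :
    root l ^ p * root (-((p : ZMod n) * (l + k))) = root (-((p : ZMod n) * k)) := by
  rw [← root_natCast_mul, ← root_add]
  congr 1
  ring

theorem conj_twistAverage (hG : G ^ n = 1) (p : ℕ) (M : Matrix (Fin N) (Fin N) ℂ) (l : ZMod n) :
    conj hG l (twistAverage hG p M) = root l ^ p • twistAverage hG p M := by
  simp only [twistAverage_apply, map_sum, map_smul, Finset.smul_sum, smul_smul]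
  refine Fintype.sum_equiv (Equiv.addLeft l) _ _ fun k => ?_
  rw [Equiv.coe_addLeft, root_pow_mul_root_neg, conj_add]

theorem twistAverage_conj (hG : G ^ n = 1) (p : ℕ) (M : Matrix (Fin N) (Fin N) ℂ) (l : ZMod n) :
    twistAverage hG p (conj hG l M) = root l ^ p • twistAverage hG p M := by
  simp only [twistAverage_apply, Finset.smul_sum, smul_smul]
  refine Fintype.sum_equiv (Equiv.addLeft l) _ _ fun k => ?_
  rw [← conj_add, Equiv.coe_addLeft, root_pow_mul_root_neg, add_comm k l]

theorem twistAverage_lie_left (hG : G ^ n = 1) (p q : ℕ) (M M' : Matrix (Fin N) (Fin N) ℂ) :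
    ⁅twistAverage hG p M, twistAverage hG q M'⁆ =
      twistAverage hG (p + q) ⁅twistAverage hG p M, M'⁆ := by
  rw [twistAverage_apply hG q, twistAverage_apply hG (p + q), lie_sum]
  refine Finset.sum_congr rfl fun k _ => ?_
  have hroot : root (-(((p + q : ℕ) : ZMod n) * k)) * root k ^ p =
      root (-((q : ZMod n) * k)) := by
    rw [← root_natCast_mul, ← root_add]
    congr 1
    push_cast
    ring
  rw [conj_lie, conj_twistAverage, smul_lie, smul_smul, hroot, lie_smul]

theorem twistAverage_lie (hG : G ^ n = 1) (p q : ℕ) (M M' : Matrix (Fin N) (Fin N) ℂ) :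
    ⁅twistAverage hG p M, twistAverage hG q M'⁆ =
      ∑ k : ZMod n, root k ^ p • twistAverage hG (p + q) ⁅conj hG (-k) M, M'⁆ := by
  rw [twistAverage_lie_left, twistAverage_apply hG p, sum_lie, map_sum]
  refine Fintype.sum_equiv (Equiv.neg _) _ _ fun k => ?_
  rw [Equiv.neg_apply, neg_neg, smul_lie, map_smul, ← root_natCast_mul, mul_neg]

/-- The element `∑ k, τ ^ (-p k) σ ^ k (M) z ^ p` of `gl_N[z]^σ`. -/
def loopGenerator (hG : G ^ n = 1) (p : ℕ) : Matrix (Fin N) (Fin N) ℂ →ₗ[ℂ] twistedLoop n G :=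
  (monoMat p ∘ₗ twistAverage hG p).codRestrict (twistedLoop n G).toSubmodule fun M => by
    refine (mem_twistedLoop_iff hG _).2 fun q => ?_
    rw [LinearMap.comp_apply, matPolyEquiv_monoMat, Polynomial.coeff_monomial]
    split_ifs with h
    · rw [conj_twistAverage, h]
    · rw [map_zero, smul_zero]

theorem coe_loopGenerator (hG : G ^ n = 1) (p : ℕ) (M : Matrix (Fin N) (Fin N) ℂ) :
    (loopGenerator hG p M : Matrix (Fin N) (Fin N) (Polynomial ℂ)) =
      monoMat p (twistAverage hG p M) := rfl

theorem loopGenerator_conj (hG : G ^ n = 1) (p : ℕ) (M : Matrix (Fin N) (Fin N) ℂ) (l : ZMod n) :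
    loopGenerator hG p (conj hG l M) = root l ^ p • loopGenerator hG p M := by
  apply Subtype.ext
  rw [coe_loopGenerator, twistAverage_conj, map_smul]
  rfl

theorem loopGenerator_lie (hG : G ^ n = 1) (p q : ℕ) (M M' : Matrix (Fin N) (Fin N) ℂ) :
    ⁅loopGenerator hG p M, loopGenerator hG q M'⁆ =
      ∑ k : ZMod n, root k ^ p • loopGenerator hG (p + q) ⁅conj hG (-k) M, M'⁆ := by
  apply Subtype.ext
  rw [LieSubalgebra.coe_bracket, coe_loopGenerator, coe_loopGenerator, monoMat_lie,
    twistAverage_lie, map_sum, AddSubmonoidClass.coe_finsetSum]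
  exact Finset.sum_congr rfl fun k _ => map_smul _ _ _

theorem sigma_iterate_monoMat (hG : G ^ n = 1) (p : ℕ) (M : Matrix (Fin N) (Fin N) ℂ) (m : ℕ) :
    (sigma G)^[m] (monoMat p M) = monoMat p (conj hG (m : ZMod n) M) := by
  induction m with
  | zero => rw [Function.iterate_zero_apply, Nat.cast_zero, conj_zero]
  | succ m ih =>
    rw [Function.iterate_succ_apply', ih, Nat.cast_succ, add_comm, conj_add]
    apply matPolyEquiv.injective
    ext1 q
    rw [coeff_sigma hG, matPolyEquiv_monoMat, matPolyEquiv_monoMat, Polynomial.coeff_monomial,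
      Polynomial.coeff_monomial, apply_ite (conj hG 1), map_zero]

theorem generator_eq (hG : G ^ n = 1) (p : ℕ) (i j : Fin N) :
    generator n G p i j = loopGenerator hG p (Matrix.single j i 1) := by
  have hsingle : Matrix.single j i ((Polynomial.X : Polynomial ℂ) ^ p) =
      monoMat p (Matrix.single j i 1) := by
    rw [monoMat, LinearMap.mapMatrix_apply, Matrix.map_single,
      Polynomial.monomial_one_right_eq_X_pow]
  simp only [generator, hsingle, sigma_iterate_monoMat hG, ZMod.natCast_zmod_val,
    coe_loopGenerator, twistAverage_apply, map_sum, map_smul]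

theorem twistAverage_one (hG : G ^ n = 1) (p : ℕ) :
    twistAverage hG p 1 = (∑ k : ZMod n, root (-((p : ZMod n) * k))) • 1 := by
  simp only [twistAverage_apply, map_one, Finset.sum_smul]

theorem loopGenerator_one_lie (hG : G ^ n = 1) (p : ℕ) (Y : twistedLoop n G) :
    ⁅loopGenerator hG p 1, Y⁆ = 0 := by
  apply Subtype.ext
  rw [LieSubalgebra.coe_bracket, coe_loopGenerator, twistAverage_one, map_smul, smul_lie,
    commute_iff_lie_eq.1 (monoMat_one_commute p Y.1), smul_zero]
  rfl

theorem sum_root_eq_zero {p : ℕ} (h : ¬ n ∣ p) :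
    ∑ k : ZMod n, root (-((p : ZMod n) * k)) = 0 := by
  have hp : -(p : ZMod n) ≠ 0 := neg_ne_zero.2 fun hp => h ((ZMod.natCast_eq_zero_iff p n).1 hp)
  simpa only [root, neg_mul, AddChar.mulShift_apply] using
    AddChar.sum_eq_zero_of_ne_one (ZMod.isPrimitive_stdAddChar n hp)

theorem loopGenerator_one_eq_zero (hG : G ^ n = 1) {p : ℕ} (h : ¬ n ∣ p) :
    loopGenerator hG p 1 = 0 := by
  apply Subtype.ext
  rw [coe_loopGenerator, twistAverage_one, sum_root_eq_zero h, zero_smul, map_zero]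
  rfl

end Generators

/-! ### Generating series -/

section Coefficients

variable {ι A : Type*} [Fintype ι] [Ring A] [Algebra ℂ A]

theorem constMat_mul_apply (M : Matrix ι ι ℂ) (B : Matrix ι ι (PowerSeries A)) (i j : ι) :
    (constMat A M * B) i j = ∑ x, M i x • B x j := by
  simp only [Matrix.mul_apply, constMat, Matrix.map_apply, Algebra.smul_def,
    PowerSeries.algebraMap_apply]

theorem mul_constMat_apply (B : Matrix ι ι (PowerSeries A)) (M : Matrix ι ι ℂ) (i j : ι) :
    (B * constMat A M) i j = ∑ x, M x j • B i x := by
  simp only [Matrix.mul_apply, constMat, Matrix.map_apply, ← PowerSeries.algebraMap_apply,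
    Algebra.smul_def, Algebra.commutes]

theorem coeff_complex_smul (m : ℕ) (c : ℂ) (f : PowerSeries A) :
    PowerSeries.coeff m (c • f) = c • PowerSeries.coeff m f := rfl

theorem coeff_dilate (c : ℂ) (m : ℕ) (f : PowerSeries A) :
    PowerSeries.coeff m (dilate c f) = c⁻¹ ^ m • PowerSeries.coeff m f :=
  PowerSeries.coeff_mk _ _

variable [DecidableEq ι] {m : ℕ} {B : Matrix ι ι (PowerSeries A)} {φ : Matrix ι ι ℂ →ₗ[ℂ] A}

theorem coeff_constMat_mul (h : ∀ i j, PowerSeries.coeff m (B i j) = φ (Matrix.single j i 1))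
    (M : Matrix ι ι ℂ) (i j : ι) :
    PowerSeries.coeff m ((constMat A M * B) i j) = φ (Matrix.single j i 1 * M) := by
  have hrow : Matrix.single j i 1 * M = ∑ x, M i x • Matrix.single j x 1 := by
    ext a b
    obtain rfl | ha := eq_or_ne a j
    · simp [Matrix.sum_apply, Matrix.single_apply]
    · simp [Matrix.sum_apply, ha, ha.symm]
  simp only [constMat_mul_apply, map_sum, coeff_complex_smul, h, hrow, map_smul]

theorem coeff_mul_constMat (h : ∀ i j, PowerSeries.coeff m (B i j) = φ (Matrix.single j i 1))
    (M : Matrix ι ι ℂ) (i j : ι) :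
    PowerSeries.coeff m ((B * constMat A M) i j) = φ (M * Matrix.single j i 1) := by
  have hcol : M * Matrix.single j i 1 = ∑ x, M x j • Matrix.single x i 1 := by
    ext a b
    obtain rfl | hb := eq_or_ne b i
    · simp [Matrix.sum_apply, Matrix.single_apply]
    · simp [Matrix.sum_apply, hb, hb.symm]
  simp only [mul_constMat_apply, map_sum, coeff_complex_smul, h, hcol, map_smul]

end Coefficients

section GeneratingSeries

variable {G : GL (Fin N) ℂ} {A : Type*} [Ring A] [Algebra ℂ A]

/-- The matrix `∑ i j, E_ij ⊗ ρ(x_ij(u))`, where `x_ij(u)` is the generating series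
`∑ p, x_p / u ^ (p + 1)` of the generators `x_p` attached to `E_ji` of the twisted loop algebra,
for a representation `ρ` of this algebra. -/
def generatingSeries (hG : G ^ n = 1) (ρ : twistedLoop n G →ₗ⁅ℂ⁆ A) :
    Matrix (Fin N) (Fin N) (PowerSeries A) :=
  Matrix.of fun i j =>
    PowerSeries.X * PowerSeries.mk fun p => ρ (loopGenerator hG p (Matrix.single j i 1))

theorem coeff_zero_generatingSeries (hG : G ^ n = 1) (ρ : twistedLoop n G →ₗ⁅ℂ⁆ A)
    (i j : Fin N) : PowerSeries.coeff 0 (generatingSeries hG ρ i j) = 0 :=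
  PowerSeries.coeff_zero_X_mul _

theorem coeff_succ_generatingSeries (hG : G ^ n = 1) (ρ : twistedLoop n G →ₗ⁅ℂ⁆ A) (p : ℕ)
    (i j : Fin N) : PowerSeries.coeff (p + 1) (generatingSeries hG ρ i j) =
      ρ (loopGenerator hG p (Matrix.single j i 1)) := by
  rw [generatingSeries, Matrix.of_apply, PowerSeries.coeff_succ_X_mul, PowerSeries.coeff_mk]

theorem coeff_zero_trace_generatingSeries (hG : G ^ n = 1) (ρ : twistedLoop n G →ₗ⁅ℂ⁆ A) :
    PowerSeries.coeff 0 (generatingSeries hG ρ).trace = 0 := by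
  rw [Matrix.trace, map_sum]
  exact Finset.sum_eq_zero fun i _ => coeff_zero_generatingSeries hG ρ i i

theorem coeff_succ_trace_generatingSeries (hG : G ^ n = 1) (ρ : twistedLoop n G →ₗ⁅ℂ⁆ A)
    (p : ℕ) : PowerSeries.coeff (p + 1) (generatingSeries hG ρ).trace =
      ρ (loopGenerator hG p 1) := by
  simp only [Matrix.trace, Matrix.diag_apply, map_sum, coeff_succ_generatingSeries]
  rw [← Matrix.sum_single_one, map_sum, map_sum]

end GeneratingSeries

section Monodromy

variable {G : GL (Fin N) ℂ}

theorem coeff_zero_monodromy (ℏ : ℝ) (lam : ℂ) (μ : ZMod n → ℂ) (i j : Fin N) :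
    PowerSeries.coeff 0 (monodromy ℏ lam μ i j : PowerSeries (Op n N L)) = 0 := by
  rw [monodromy, Matrix.of_apply, map_sum]
  refine Finset.sum_eq_zero fun ℓ _ => ?_
  rw [PowerSeries.coeff_C_mul, PowerSeries.coeff_zero_X_mul, mul_zero]

theorem coeff_succ_monodromy (ℏ : ℝ) (lam : ℂ) (μ : ZMod n → ℂ) (p : ℕ) (i j : Fin N) :
    PowerSeries.coeff (p + 1) (monodromy ℏ lam μ i j : PowerSeries (Op n N L)) =
      loopRep ℏ lam μ (monoMat p (Matrix.single j i 1)) := by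
  rw [loopRep_monoMat, monodromy, Matrix.of_apply, map_sum]
  refine Finset.sum_congr rfl fun ℓ _ => ?_
  rw [PowerSeries.coeff_C_mul, PowerSeries.coeff_succ_X_mul, PowerSeries.coeff_mk]

theorem coeff_zero_twisted (G : GL (Fin N) ℂ) (ℏ : ℝ) (lam : ℂ) (μ : ZMod n → ℂ) (i j : Fin N) :
    PowerSeries.coeff 0 (twisted G ℏ lam μ i j : PowerSeries (Op n N L)) = 0 := by
  rw [twisted, Matrix.sum_apply, map_sum]
  refine Finset.sum_eq_zero fun k _ => ?_
  rw [Matrix.smul_apply, coeff_complex_smul, mul_constMat_apply, map_sum]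
  refine smul_eq_zero_of_right _ (Finset.sum_eq_zero fun y _ => ?_)
  rw [coeff_complex_smul, constMat_mul_apply, map_sum]
  refine smul_eq_zero_of_right _ (Finset.sum_eq_zero fun x _ => ?_)
  rw [coeff_complex_smul, Matrix.map_apply, coeff_dilate, coeff_zero_monodromy, smul_zero,
    smul_zero]

theorem coeff_succ_twisted (ℏ : ℝ) (lam : ℂ) (μ : ZMod n → ℂ) (hG : G ^ n = 1) (p : ℕ)
    (i j : Fin N) : PowerSeries.coeff (p + 1) (twisted G ℏ lam μ i j : PowerSeries (Op n N L)) =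
      loopRep ℏ lam μ (loopGenerator hG p (Matrix.single j i 1)).1 := by
  set φ : Matrix (Fin N) (Fin N) ℂ →ₗ[ℂ] Op n N L :=
    (loopRep (N := N) (L := L) ℏ lam μ).toLinearMap ∘ₗ monoMat p
  have hmonodromy (k : ZMod n) (i j : Fin N) : PowerSeries.coeff (p + 1)
      ((monodromy ℏ lam μ : Matrix (Fin N) (Fin N) (PowerSeries (Op n N L))).map
        (dilate (root k)) i j) = ((root k)⁻¹ ^ (p + 1) • φ) (Matrix.single j i 1) := by
    rw [Matrix.map_apply, coeff_dilate, coeff_succ_monodromy]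
    rfl
  have hroot (k : ZMod n) : root k * (root k)⁻¹ ^ (p + 1) = root (-((p : ZMod n) * k)) := by
    rw [pow_succ', mul_inv_cancel_left₀ (root_ne_zero k), inv_pow, ← root_natCast_mul]
    exact (AddChar.map_neg_eq_inv _ _).symm
  rw [coe_loopGenerator, twistAverage_apply, map_sum, map_sum, twisted, Matrix.sum_apply, map_sum]
  refine Finset.sum_congr rfl fun k _ => ?_
  have hconj := coeff_mul_constMat
    (φ := ((root k)⁻¹ ^ (p + 1) • φ) ∘ₗ LinearMap.mulRight ℂ (gpow G k))
    (coeff_constMat_mul (hmonodromy k) (gpow G k)) (gpow G (-k)) i j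
  rw [Matrix.smul_apply, coeff_complex_smul, hconj, ← hroot, map_smul, map_smul, mul_smul]
  rfl

theorem modified_eq_generatingSeries (ℏ : ℝ) (lam : ℂ) (μ : ZMod n → ℂ) (hG : G ^ n = 1) {ε : ℂ}
    (hε : ε * ε = 1) :
    (modified G ε ℏ lam μ : Matrix (Fin N) (Fin N) (PowerSeries (Op n N L))) =
      generatingSeries hG (twistedRep (L := L) ℏ lam μ hG hε) := by
  ext i j m : 3
  rw [modified, Matrix.map_apply, PowerSeries.coeff_mul_C]
  cases m with
  | zero => rw [coeff_zero_twisted, zero_mul, coeff_zero_generatingSeries]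
  | succ p => rw [coeff_succ_twisted ℏ lam μ hG, coeff_succ_generatingSeries, twistedRep_apply,
      physProj]

theorem coeff_succ_modified (ℏ : ℝ) (lam : ℂ) (μ : ZMod n → ℂ) (hG : G ^ n = 1) {ε : ℂ}
    (hε : ε * ε = 1) (p : ℕ) (i j : Fin N) :
    PowerSeries.coeff (p + 1) (modified G ε ℏ lam μ i j : PowerSeries (Op n N L)) =
      twistedRep ℏ lam μ hG hε (loopGenerator hG p (Matrix.single j i 1)) := by
  rw [modified_eq_generatingSeries ℏ lam μ hG hε, coeff_succ_generatingSeries]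

theorem coeff_modified_mem_physical (ℏ : ℝ) (lam : ℂ) (μ : ZMod n → ℂ) (hG : G ^ n = 1) {ε : ℂ}
    (hε : ε * ε = 1) (i j : Fin N) (m : ℕ) (ψ : WaveFn n N L) :
    PowerSeries.coeff m (modified G ε ℏ lam μ i j) ψ ∈ physical n L ε G := by
  cases m with
  | zero =>
    rw [modified_eq_generatingSeries ℏ lam μ hG hε, coeff_zero_generatingSeries]
    exact zero_mem _
  | succ p =>
    rw [coeff_succ_modified ℏ lam μ hG hε]
    exact twistedRep_mem_physical ℏ lam μ hG hε _ ψ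

theorem charge_eq (ℏ : ℝ) (lam : ℂ) (μ : ZMod n → ℂ) (hG : G ^ n = 1) {ε : ℂ} (hε : ε * ε = 1)
    (k : ℕ) : (charge G ε ℏ lam μ k : Op n N L) =
      twistedRep ℏ lam μ hG hε (loopGenerator hG k 1) := by
  rw [charge, modified_eq_generatingSeries ℏ lam μ hG hε, coeff_succ_trace_generatingSeries]

theorem charge_eq_zero (ℏ : ℝ) (lam : ℂ) (μ : ZMod n → ℂ) (hG : G ^ n = 1) {ε : ℂ}
    (hε : ε * ε = 1) {k : ℕ} (h : ¬ n ∣ k) : (charge G ε ℏ lam μ k : Op n N L) = 0 := by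
  rw [charge_eq ℏ lam μ hG hε, loopGenerator_one_eq_zero hG h, map_zero]

theorem twistedRep_commute_charge (ℏ : ℝ) (lam : ℂ) (μ : ZMod n → ℂ) (hG : G ^ n = 1) {ε : ℂ}
    (hε : ε * ε = 1) (Y : twistedLoop n G) (k : ℕ) :
    Commute (twistedRep ℏ lam μ hG hε Y : Op n N L) (charge G ε ℏ lam μ k) := by
  refine Commute.symm (commute_iff_lie_eq.2 ?_)
  rw [charge_eq ℏ lam μ hG hε, ← LieHom.map_lie, loopGenerator_one_lie, map_zero]

theorem charge_commute_charge (ℏ : ℝ) (lam : ℂ) (μ : ZMod n → ℂ) (hG : G ^ n = 1) {ε : ℂ}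
    (hε : ε * ε = 1) (k l : ℕ) :
    Commute (charge G ε ℏ lam μ k : Op n N L) (charge G ε ℏ lam μ l) :=
  charge_eq ℏ lam μ hG hε k ▸ twistedRep_commute_charge ℏ lam μ hG hε _ l

end Monodromy

/-! ### The half-loop relations of a representation -/

section TwoVariables

variable {A : Type*} [Ring A]

theorem coeff_inU (m : ℕ) (f : PowerSeries A) :
    PowerSeries.coeff m (inU f) =
      HahnSeries.ofPowerSeries ℤ A (PowerSeries.C (PowerSeries.coeff m f)) := by
  rw [inU, PowerSeries.coeff_map, HahnSeries.ofPowerSeries_C]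

theorem coeff_inV (m : ℕ) (f : PowerSeries A) : PowerSeries.coeff m (inV f) =
    if m = 0 then HahnSeries.ofPowerSeries ℤ A f else 0 :=
  PowerSeries.coeff_C _ _

theorem coeff_lie_inU_inV (p : ℕ) (f g : PowerSeries A) :
    PowerSeries.coeff p ⁅inU f, inV g⁆ = HahnSeries.ofPowerSeries ℤ A
      (PowerSeries.mk fun q => ⁅PowerSeries.coeff p f, PowerSeries.coeff q g⁆) := by
  have hmk : (PowerSeries.mk fun q => ⁅PowerSeries.coeff p f, PowerSeries.coeff q g⁆) =
      PowerSeries.C (PowerSeries.coeff p f) * g - g * PowerSeries.C (PowerSeries.coeff p f) := by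
    ext q
    rw [PowerSeries.coeff_mk, map_sub, PowerSeries.coeff_C_mul, PowerSeries.coeff_mul_C,
      Ring.lie_def]
  rw [hmk, map_sub, map_mul, map_mul, ← coeff_inU, Ring.lie_def, map_sub]
  exact congrArg₂ _ (PowerSeries.coeff_mul_C _ _ _) (PowerSeries.coeff_C_mul _ _ _)

variable [Algebra ℂ A]

theorem scalar_eq_algebraMap (c : ℂ) : (scalar c : TwoSeries A) = algebraMap ℂ (TwoSeries A) c := by
  rw [PowerSeries.algebraMap_apply, HahnSeries.algebraMap_apply]
  rfl

theorem inU_smul (c : ℂ) (f : PowerSeries A) : inU (c • f) = c • inU f := by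
  rw [Algebra.smul_def, map_mul, Algebra.smul_def, ← scalar_eq_algebraMap,
    PowerSeries.algebraMap_apply, inU, PowerSeries.map_C]
  rfl

theorem inV_smul (c : ℂ) (f : PowerSeries A) : inV (c • f) = c • inV f := by
  rw [Algebra.smul_def, map_mul, Algebra.smul_def, ← scalar_eq_algebraMap,
    PowerSeries.algebraMap_apply, inV, RingHom.comp_apply, HahnSeries.ofPowerSeries_C]
  rfl

theorem kernel_commute (c : ℂ) (W : TwoSeries A) : Commute (kernel c) W := by
  have hsingle (m : ℤ) (x : LaurentSeries A) (a : ℂ) :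
      Commute (HahnSeries.single m (algebraMap ℂ A a)) x := by
    ext q
    obtain ⟨b, rfl⟩ : ∃ b, q = b + m := ⟨q - m, (sub_add_cancel q m).symm⟩
    rw [HahnSeries.coeff_mul_single_add, HahnSeries.coeff_single_mul_add, Algebra.commutes]
  refine (PowerSeries.commute_X W).symm.mul_left (PowerSeries.ext fun p => ?_)
  rw [PowerSeries.coeff_mul, PowerSeries.coeff_mul, ← Finset.Nat.sum_antidiagonal_swap]
  refine Finset.sum_congr rfl fun x _ => ?_
  rw [Prod.fst_swap, Prod.snd_swap, PowerSeries.coeff_mk]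
  exact hsingle _ _ _

/-- The divided difference `(f(v) - f(u / c)) / (u - c * v)`. -/
def dividedDifference (c : ℂ) (f : PowerSeries A) : TwoSeries A :=
  kernel c * (inV f - inU (dilate c⁻¹ f))

theorem dividedDifference_eq (c : ℂ) (f : PowerSeries A) :
    dividedDifference c f = PowerSeries.X * (inV f - inU (dilate c⁻¹ f) +
      PowerSeries.C (HahnSeries.single (-1) (algebraMap ℂ A c)) * dividedDifference c f) := by
  have hkernel : (kernel c : TwoSeries A) = PowerSeries.X + PowerSeries.X *
      (PowerSeries.C (HahnSeries.single (-1) (algebraMap ℂ A c)) * kernel c) := by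
    have hspec := kernel_spec (A := A) c
    rwa [sub_mul, one_mul, sub_eq_iff_eq_add, (PowerSeries.commute_X _).eq, mul_assoc] at hspec
  rw [dividedDifference]
  nth_rw 1 [hkernel]
  rw [add_mul, mul_add, mul_assoc, mul_assoc]

theorem coeff_zero_dividedDifference (c : ℂ) (f : PowerSeries A) :
    PowerSeries.coeff 0 (dividedDifference c f) = 0 := by
  rw [dividedDifference_eq, PowerSeries.coeff_zero_X_mul]

theorem single_mul_ofPowerSeries_X_mul (c : ℂ) (f : PowerSeries A) :
    HahnSeries.single (-1) (algebraMap ℂ A c) * HahnSeries.ofPowerSeries ℤ A (PowerSeries.X * f) =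
      HahnSeries.ofPowerSeries ℤ A (c • f) := by
  rw [map_mul, HahnSeries.ofPowerSeries_X, ← mul_assoc, HahnSeries.single_mul_single,
    neg_add_cancel, mul_one, Algebra.smul_def, map_mul, PowerSeries.algebraMap_apply,
    HahnSeries.ofPowerSeries_C]
  rfl

theorem coeff_succ_dividedDifference (c : ℂ) {f : PowerSeries A} (hf : PowerSeries.coeff 0 f = 0)
    (p : ℕ) : PowerSeries.coeff (p + 1) (dividedDifference c f) =
      HahnSeries.ofPowerSeries ℤ A (PowerSeries.X *
        PowerSeries.mk fun q => c ^ p • PowerSeries.coeff (p + q + 1) f) := by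
  induction p with
  | zero =>
    rw [dividedDifference_eq, PowerSeries.coeff_succ_X_mul, map_add, map_sub,
      PowerSeries.coeff_C_mul, coeff_zero_dividedDifference, mul_zero, add_zero, coeff_inV,
      if_pos rfl, coeff_inU, ← map_sub]
    congr 1
    ext q
    cases q <;> simp [hf, coeff_dilate, PowerSeries.coeff_succ_X_mul]
  | succ p ih =>
    rw [dividedDifference_eq, PowerSeries.coeff_succ_X_mul, map_add, map_sub,
      PowerSeries.coeff_C_mul, ih, single_mul_ofPowerSeries_X_mul, coeff_inV,
      if_neg p.succ_ne_zero, coeff_inU, zero_sub, ← map_neg, ← map_add]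
    congr 1
    ext q
    cases q with
    | zero =>
      simp [coeff_dilate, smul_smul, pow_succ']
    | succ q =>
      simp [PowerSeries.coeff_succ_X_mul, smul_smul, pow_succ', add_right_comm p 1, ← add_assoc]

theorem ofPowerSeries_complex_smul (c : ℂ) (f : PowerSeries A) :
    HahnSeries.ofPowerSeries ℤ A (c • f) = c • HahnSeries.ofPowerSeries ℤ A f :=
  map_smul (HahnSeries.ofPowerSeriesAlg ℤ ℂ) c f

end TwoVariables

section Auxiliary

variable {R : Type*} [Ring R]

theorem inA_mul_apply (Y : Matrix (Fin N) (Fin N) R) (K : AuxMat N R) (i r j s : Fin N) :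
    (inA Y * K) (i, r) (j, s) = ∑ x, Y i x * K (x, r) (j, s) := by
  simp [inA, Matrix.mul_apply, Fintype.sum_prod_type, Matrix.one_apply]

theorem mul_inA_apply (K : AuxMat N R) (Y : Matrix (Fin N) (Fin N) R) (i r j s : Fin N) :
    (K * inA Y) (i, r) (j, s) = ∑ x, K (i, r) (x, s) * Y x j := by
  simp [inA, Matrix.mul_apply, Fintype.sum_prod_type, Matrix.one_apply]

theorem inB_mul_apply (Y : Matrix (Fin N) (Fin N) R) (K : AuxMat N R) (i r j s : Fin N) :
    (inB Y * K) (i, r) (j, s) = ∑ x, Y r x * K (i, x) (j, s) := by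
  simp [inB, Matrix.mul_apply, Fintype.sum_prod_type, Matrix.one_apply]

theorem mul_inB_apply (K : AuxMat N R) (Y : Matrix (Fin N) (Fin N) R) (i r j s : Fin N) :
    (K * inB Y) (i, r) (j, s) = ∑ x, K (i, r) (j, x) * Y x s := by
  simp [inB, Matrix.mul_apply, Fintype.sum_prod_type, Matrix.one_apply]

theorem permAB_apply (i r j s : Fin N) :
    permAB N (i, r) (j, s) = if i = s ∧ r = j then 1 else 0 := by
  simp [permAB, Matrix.sum_apply, Matrix.single_apply, ite_and, @eq_comm _ s i]

theorem inA_mul_permAB_mul_inA_apply (M M' : Matrix (Fin N) (Fin N) ℂ) (i r j s : Fin N) :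
    (inA M * permAB N * inA M') (i, r) (j, s) = M i s * M' r j := by
  simp [mul_inA_apply, inA_mul_apply, permAB_apply, ite_and]

theorem lie_inA_inB_apply (Y Y' : Matrix (Fin N) (Fin N) R) (i r j s : Fin N) :
    ⁅inA Y, inB Y'⁆ (i, r) (j, s) = ⁅Y i j, Y' r s⁆ := by
  rw [Ring.lie_def, Matrix.sub_apply, inA_mul_apply, mul_inA_apply, Ring.lie_def]
  simp [inB, Matrix.one_apply]

end Auxiliary

section HalfLoop

variable {A : Type*} [Ring A] [Algebra ℂ A]

theorem mul_kernel_smul (c : ℂ) (Y K : AuxMat N (TwoSeries A)) :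
    Y * (kernel c : TwoSeries A) • K = (kernel c : TwoSeries A) • (Y * K) := by
  ext1 x y
  simp only [Matrix.mul_apply, Matrix.smul_apply, smul_eq_mul, Finset.mul_sum]
  refine Finset.sum_congr rfl fun z _ => ?_
  rw [← mul_assoc, ← (kernel_commute c (Y x z)).eq, mul_assoc]

theorem halfLoop_bracket_apply (c : ℂ) {B : Matrix (Fin N) (Fin N) (PowerSeries A)}
    {M M' : Matrix (Fin N) (Fin N) ℂ} {i r j s : Fin N}
    (hM : c • (B * constMat A M) i s = dilate c⁻¹ ((constMat A M * B) i s))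
    (hM' : c • (constMat A M' * B) r j = dilate c⁻¹ ((B * constMat A M') r j)) :
    ⁅(scalar c : TwoSeries A) • inA (B.map inU) + inB (B.map inV),
      (kernel c : TwoSeries A) • (inA M * permAB N * inA M').map scalar⁆ (i, r) (j, s) =
      M i s • dividedDifference c ((B * constMat A M') r j) -
        M' r j • dividedDifference c ((constMat A M * B) i s) := by
  set K : AuxMat N (TwoSeries A) := (inA M * permAB N * inA M').map scalar
  have hK (i r j s : Fin N) : K (i, r) (j, s) = algebraMap ℂ _ (M i s * M' r j) := by
    rw [← scalar_eq_algebraMap, ← inA_mul_permAB_mul_inA_apply]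
    rfl
  have hUK : (inA (B.map inU) * K) (i, r) (j, s) = M' r j • inU ((B * constMat A M) i s) := by
    simp only [inA_mul_apply, hK, ← Algebra.commutes, ← Algebra.smul_def, Matrix.map_apply,
      mul_constMat_apply, map_sum, inU_smul, Finset.smul_sum, smul_smul, mul_comm]
  have hKU : (K * inA (B.map inU)) (i, r) (j, s) = M i s • inU ((constMat A M' * B) r j) := by
    simp only [mul_inA_apply, hK, ← Algebra.smul_def, Matrix.map_apply, constMat_mul_apply,
      map_sum, inU_smul, Finset.smul_sum, smul_smul]
  have hVK : (inB (B.map inV) * K) (i, r) (j, s) = M i s • inV ((B * constMat A M') r j) := by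
    simp only [inB_mul_apply, hK, ← Algebra.commutes, ← Algebra.smul_def, Matrix.map_apply,
      mul_constMat_apply, map_sum, inV_smul, Finset.smul_sum, smul_smul]
  have hKV : (K * inB (B.map inV)) (i, r) (j, s) = M' r j • inV ((constMat A M * B) i s) := by
    simp only [mul_inB_apply, hK, ← Algebra.smul_def, Matrix.map_apply, constMat_mul_apply,
      map_sum, inV_smul, Finset.smul_sum, smul_smul, mul_comm]
  rw [Ring.lie_def, mul_kernel_smul, smul_mul_assoc, ← smul_sub, scalar_eq_algebraMap,
    algebraMap_smul, add_mul, mul_add, smul_mul_assoc, mul_smul_comm]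
  simp only [Matrix.smul_apply, Matrix.sub_apply, Matrix.add_apply, hUK, hKU, hVK, hKV,
    smul_comm c, ← inU_smul, hM, hM']
  simp only [dividedDifference, inU_smul, smul_eq_mul, mul_sub, mul_add, mul_smul_comm, smul_sub]
  abel

variable {G : GL (Fin N) ℂ} (hG : G ^ n = 1) (ρ : twistedLoop n G →ₗ⁅ℂ⁆ A)

theorem lie_loopGenerator_single (p q : ℕ) (i j r s : Fin N) :
    ⁅ρ (loopGenerator hG p (Matrix.single j i 1)), ρ (loopGenerator hG q (Matrix.single s r 1))⁆ =
      ∑ k : ZMod n, (gpow G (-k) i s •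
          root k ^ p • ρ (loopGenerator hG (p + q) (gpow G k * Matrix.single j r 1)) -
        gpow G k r j •
          root k ^ p • ρ (loopGenerator hG (p + q) (Matrix.single s i 1 * gpow G (-k)))) := by
  rw [← LieHom.map_lie, loopGenerator_lie, map_sum]
  refine Finset.sum_congr rfl fun k _ => ?_
  have hleft : conj hG (-k) (Matrix.single j i 1) * Matrix.single s r 1 =
      gpow G (-k) i s • (gpow G k * Matrix.single j r 1) := by
    rw [conj_apply, neg_neg, mul_assoc, mul_assoc, ← mul_assoc (Matrix.single j i 1),
      Matrix.single_mul_mul_single, ← mul_smul_comm, Matrix.smul_single]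
    simp
  have hright : Matrix.single s r 1 * conj hG (-k) (Matrix.single j i 1) =
      gpow G k r j • (Matrix.single s i 1 * gpow G (-k)) := by
    rw [conj_apply, neg_neg, ← mul_assoc, ← mul_assoc, Matrix.single_mul_mul_single,
      ← smul_mul_assoc, Matrix.smul_single]
    simp
  simp only [Ring.lie_def, hleft, hright, map_sub, map_smul, smul_sub, smul_comm (root k ^ p)]

theorem coeff_zero_constMat_mul_generatingSeries (M : Matrix (Fin N) (Fin N) ℂ) (i j : Fin N) :
    PowerSeries.coeff 0 ((constMat A M * generatingSeries hG ρ) i j) = 0 :=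
  coeff_constMat_mul (φ := 0) (coeff_zero_generatingSeries hG ρ) M i j

theorem coeff_zero_generatingSeries_mul_constMat (M : Matrix (Fin N) (Fin N) ℂ) (i j : Fin N) :
    PowerSeries.coeff 0 ((generatingSeries hG ρ * constMat A M) i j) = 0 :=
  coeff_mul_constMat (φ := 0) (coeff_zero_generatingSeries hG ρ) M i j

theorem coeff_succ_constMat_mul_generatingSeries (M : Matrix (Fin N) (Fin N) ℂ) (i j : Fin N)
    (p : ℕ) : PowerSeries.coeff (p + 1) ((constMat A M * generatingSeries hG ρ) i j) =
      ρ (loopGenerator hG p (Matrix.single j i 1 * M)) :=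
  coeff_constMat_mul (φ := ρ.toLinearMap ∘ₗ loopGenerator hG p)
    (coeff_succ_generatingSeries hG ρ p) M i j

theorem coeff_succ_generatingSeries_mul_constMat (M : Matrix (Fin N) (Fin N) ℂ) (i j : Fin N)
    (p : ℕ) : PowerSeries.coeff (p + 1) ((generatingSeries hG ρ * constMat A M) i j) =
      ρ (loopGenerator hG p (M * Matrix.single j i 1)) :=
  coeff_mul_constMat (φ := ρ.toLinearMap ∘ₗ loopGenerator hG p)
    (coeff_succ_generatingSeries hG ρ p) M i j

theorem smul_eq_dilate_of_conj {f g : PowerSeries A} {M : Matrix (Fin N) (Fin N) ℂ} {k : ZMod n}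
    (hf₀ : PowerSeries.coeff 0 f = 0) (hg₀ : PowerSeries.coeff 0 g = 0)
    (hf : ∀ p, PowerSeries.coeff (p + 1) f = ρ (loopGenerator hG p (conj hG k M)))
    (hg : ∀ p, PowerSeries.coeff (p + 1) g = ρ (loopGenerator hG p M)) :
    root k • f = dilate (root k)⁻¹ g := by
  ext1 m
  rw [coeff_complex_smul, coeff_dilate, inv_inv]
  cases m with
  | zero => rw [hf₀, hg₀, smul_zero, smul_zero]
  | succ p => rw [hf, hg, loopGenerator_conj, map_smul, smul_smul, pow_succ']

theorem smul_generatingSeries_mul_constMat (k : ZMod n) (i j : Fin N) :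
    root k • (generatingSeries hG ρ * constMat A (gpow G (-k))) i j =
      dilate (root k)⁻¹ ((constMat A (gpow G (-k)) * generatingSeries hG ρ) i j) := by
  have hconj : conj hG k (Matrix.single j i 1 * gpow G (-k)) =
      gpow G (-k) * Matrix.single j i 1 := by
    rw [conj_apply, mul_assoc, mul_assoc, gpow_neg_mul hG, mul_one]
  exact smul_eq_dilate_of_conj hG ρ (coeff_zero_generatingSeries_mul_constMat hG ρ _ i j)
    (coeff_zero_constMat_mul_generatingSeries hG ρ _ i j)
    (hconj ▸ coeff_succ_generatingSeries_mul_constMat hG ρ _ i j)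
    (coeff_succ_constMat_mul_generatingSeries hG ρ _ i j)

theorem smul_constMat_mul_generatingSeries (k : ZMod n) (i j : Fin N) :
    root k • (constMat A (gpow G k) * generatingSeries hG ρ) i j =
      dilate (root k)⁻¹ ((generatingSeries hG ρ * constMat A (gpow G k)) i j) := by
  have hconj : conj hG k (gpow G k * Matrix.single j i 1) = Matrix.single j i 1 * gpow G k := by
    rw [conj_apply, ← mul_assoc, gpow_neg_mul hG, one_mul]
  exact smul_eq_dilate_of_conj hG ρ (coeff_zero_constMat_mul_generatingSeries hG ρ _ i j)
    (coeff_zero_generatingSeries_mul_constMat hG ρ _ i j)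
    (hconj ▸ coeff_succ_constMat_mul_generatingSeries hG ρ _ i j)
    (coeff_succ_generatingSeries_mul_constMat hG ρ _ i j)

theorem twistedHalfLoop_generatingSeries : TwistedHalfLoop n G (generatingSeries hG ρ) := by
  refine Matrix.ext fun ⟨i, r⟩ ⟨j, s⟩ => PowerSeries.ext fun p => ?_
  rw [lie_inA_inB_apply, Matrix.sum_apply, Finset.sum_congr rfl fun k _ =>
    halfLoop_bracket_apply (root k) (smul_generatingSeries_mul_constMat hG ρ k i s)
      (smul_constMat_mul_generatingSeries hG ρ k r j)]
  rw [Matrix.map_apply, Matrix.map_apply, coeff_lie_inU_inV, map_sum]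
  simp only [map_sub, coeff_complex_smul]
  cases p with
  | zero =>
    simp only [coeff_zero_dividedDifference, coeff_zero_generatingSeries, zero_lie, smul_zero,
      sub_zero, Finset.sum_const_zero]
    exact map_zero _
  | succ p =>
    simp only [
      coeff_succ_dividedDifference _ (coeff_zero_constMat_mul_generatingSeries hG ρ _ i s),
      coeff_succ_dividedDifference _ (coeff_zero_generatingSeries_mul_constMat hG ρ _ r j),
      ← ofPowerSeries_complex_smul, ← map_sub, ← map_sum]
    congr 1
    ext1 q
    rw [PowerSeries.coeff_mk, map_sum]
    simp only [map_sub, coeff_complex_smul]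
    cases q with
    | zero => simp [coeff_zero_generatingSeries]
    | succ q =>
      simp only [PowerSeries.coeff_succ_X_mul, PowerSeries.coeff_mk, coeff_succ_generatingSeries,
        lie_loopGenerator_single, coeff_succ_generatingSeries_mul_constMat,
        coeff_succ_constMat_mul_generatingSeries]

end HalfLoop

end TwistedCalogero

end

theorem mainTheorem6 (n N L : ℕ) [NeZero n] (G : GL (Fin N) ℂ) (hG : G ^ n = 1)
    (ε : ℂ) (hε : ε = 1 ∨ ε = -1) (ℏ : ℝ) (lam : ℂ) (μ : ZMod n → ℂ) :
    -- the operator `Λ_P Λ_Q` is the projector onto the physical states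
    LinearMap.IsProj (physical n L ε G) (statProj ε * parityProj G : Op n N L) ∧
    -- the modified generators preserve exchange statistics and quasi-parity
    (∀ (i j : Fin N) (m : ℕ) (ψ : WaveFn n N L),
      PowerSeries.coeff m (modified G ε ℏ lam μ i j) ψ ∈ physical n L ε G) ∧
    -- they satisfy the twisted half-loop relations
    TwistedHalfLoop n G (modified G ε ℏ lam μ : Matrix (Fin N) (Fin N) (PowerSeries (Op n N L))) ∧
    -- the trace has no constant term, its other coefficients being the charges, which commute
    PowerSeries.coeff 0
      (modified G ε ℏ lam μ : Matrix (Fin N) (Fin N) (PowerSeries (Op n N L))).trace = 0 ∧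
    (∀ k l : ℕ, Commute (charge G ε ℏ lam μ k : Op n N L) (charge G ε ℏ lam μ l)) ∧
    -- and vanish unless `k` is divisible by `n`
    (∀ k : ℕ, ¬ n ∣ k → (charge G ε ℏ lam μ k : Op n N L) = 0) ∧
    -- the modified generators represent `gl_N[z]^σ` on the physical states, by operators which
    -- commute with all charges
    ∃ ρ : twistedLoop n G →ₗ⁅ℂ⁆ Op n N L,
      (∀ (p : ℕ) (i j : Fin N), ∃ x : twistedLoop n G,
        (x : Matrix (Fin N) (Fin N) (Polynomial ℂ)) = generator n G p i j ∧
        ρ x = PowerSeries.coeff (p + 1) (modified G ε ℏ lam μ i j)) ∧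
      (∀ (x : twistedLoop n G) (ψ : WaveFn n N L), ρ x ψ ∈ physical n L ε G) ∧
      (∀ (x : twistedLoop n G) (k : ℕ), Commute (ρ x) (charge G ε ℏ lam μ k)) := by
  have hε' : ε * ε = 1 := by rcases hε with rfl | rfl <;> norm_num
  have hB := modified_eq_generatingSeries (L := L) ℏ lam μ hG hε'
  exact ⟨isProj_physProj hG hε', coeff_modified_mem_physical ℏ lam μ hG hε',
    hB ▸ twistedHalfLoop_generatingSeries hG _, hB ▸ coeff_zero_trace_generatingSeries hG _,
    charge_commute_charge ℏ lam μ hG hε', fun _ => charge_eq_zero ℏ lam μ hG hε',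
    twistedRep ℏ lam μ hG hε',
    fun p i j => ⟨loopGenerator hG p (Matrix.single j i 1), (generator_eq hG p i j).symm,
      (coeff_succ_modified ℏ lam μ hG hε' p i j).symm⟩,
    twistedRep_mem_physical ℏ lam μ hG hε', twistedRep_commute_charge ℏ lam μ hG hε'⟩
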